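/- There are sequences $\epsilon(n) \in \mathbb{R}$ and $D(n) \in \mathbb{N}$ with $\epsilon(n) \le \ln n$ for all large $n$, $\epsilon(n) = \ln n - O(\ln\ln n)$, and $D(n) = \Theta(n/\log^k n)$ for some constant $k \in \mathbb{N}$, such that no public-coin $(\epsilon, n^{-\omega(1)})$-locally differentially private protocol solves $\mathsf{CountDistinct}_{n,D}$ with error $o(D)$. Precisely: for every $\delta(n) \le n^{-\omega(1)}$ and every $e(n) = o(D(n))$, for all sufficiently large $n$ no public-coin $(\epsilon(n),\delta(n))$-locally differentially private protocol on $n$ users with inputs in $[D(n)]$ solves $\mathsf{CountDistinct}_{n,D(n)}$ with error $e(n)$. Here a public-coin local protocol on $n$ users with inputs in $[D]$ draws a public random string $\alpha \in \{0,1\}^*$ from a fixed distribution $\mathcal{D}_{\mathrm{pub}}$; given $\alpha$, each user $i$ independently applies the same randomizer $R_\alpha$ to their input $x_i\in[D]$ and sends the resulting message, a random element of an arbitrary measurable space $\mathcal{M}$; and a randomized analyzer $A_\alpha$ maps the tuple of the $n$ messages to a real number. The protocol is $(\epsilon,\delta)$-locally differentially private if for all $x,x'\in[D]$ and every measurable $S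 \subseteq \{0,1\}^*\times\mathcal{M}$, $\Pr[(\alpha,R_\alpha(x))\in S] \le e^{\epsilon}\Pr[(\alpha,R_\alpha(x'))\in S]+\delta$. It solves $\mathsf{CountDistinct}_{n,D}$ with error $e$ if for every $(x_1,\dots,x_n)\in[D]^n$, with probability at least $0.99$ over all the randomness, its output differs from $|\{x_1,\dots,x_n\}|$ by at most $e$. -/

import Mathlib

open MeasureTheory ProbabilityTheory Filter Asymptotics
open scoped ENNReal

universe u

/-- A (non-interactive) public-coin local protocol on `n` users with inputs from `X` and messages
in the measurable space `M`. The public coins are a finite bit string with distribution `pub`,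
which is given to the users and to the analyzer. Given the public string `a`, every user applies
the same private randomizer `R a` to their own input, and the analyzer applies `A a` to the tuple
of all `n` messages and outputs a (random) real number. -/
structure PublicCoinLocalProtocol (n : ℕ) (X : Type) (M : Type u) [MeasurableSpace M] where
  /-- the distribution of the public random string -/
  pub : PMF (List Bool)
  /-- the randomizer: the law of the message, given the public string and the user's input -/
  R : List Bool → X → ProbabilityMeasure M
  /-- the analyzer: the law of the output, given the public string and the transcript -/
  A : List Bool → Kernel (Fin n → M) ℝ
  /-- the analyzer always outputs something -/
  markov : ∀ a, IsMarkovKernel (A a)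

namespace PublicCoinLocalProtocol

variable {n : ℕ} {X : Type} {M : Type u} [MeasurableSpace M]

/-- The probability that `(a, R a x)` lies in `{(a, m) | m ∈ S a}`, where `a` is drawn from the
public distribution. -/
noncomputable def viewProb (P : PublicCoinLocalProtocol n X M) (x : X)
    (S : List Bool → Set M) : ℝ≥0∞ :=
  ∑' a, P.pub a * (P.R a x : Measure M) (S a)

/-- `(ε, δ)`-differential privacy in the public-coin local model: the randomized map
`x ↦ (a, R a x)`, with `a` drawn from the public distribution, is `(ε, δ)`-DP. Any two inputs of a
single user are neighbouring. There are countably many strings, so the events of the pair are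
exactly the sets all of whose sections `S a` are measurable. -/
def IsLocallyDP (P : PublicCoinLocalProtocol n X M) (ε δ : ℝ) : Prop :=
  ∀ x x' : X, ∀ S : List Bool → Set M, (∀ a, MeasurableSet (S a)) →
    P.viewProb x S ≤ ENNReal.ofReal (Real.exp ε) * P.viewProb x' S + ENNReal.ofReal δ

/-- The law of the output of the protocol on the dataset `x`: draw the public string, let all
users randomize their inputs independently, and apply the analyzer. -/
noncomputable def output (P : PublicCoinLocalProtocol n X M) (x : Fin n → X) : Measure ℝ :=
  Measure.sum fun a =>
    P.pub a • (Measure.pi fun i => (P.R a (x i) : Measure M)).bind (P.A a)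

/-- The number of distinct elements in a dataset. -/
noncomputable def countDistinct (x : Fin n → X) : ℕ := (Set.range x).ncard

/-- The protocol counts distinct elements with error `e`: on every dataset, with probability at
least `0.99`, the output differs from the number of distinct elements by at most `e`. -/
def SolvesCountDistinct (P : PublicCoinLocalProtocol n X M) (e : ℝ) : Prop :=
  ∀ x : Fin n → X,
    ENNReal.ofReal 0.99 ≤ P.output x {v : ℝ | |v - (countDistinct x : ℝ)| ≤ e}

end PublicCoinLocalProtocol

/-- `δ n = n ^ (-ω(1))`, as an upper bound. -/
def IsSuperpolynomiallySmall (δ : ℕ → ℝ) : Prop :=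
  ∃ g : ℕ → ℝ, Tendsto g atTop atTop ∧ ∀ᶠ n : ℕ in atTop, δ n ≤ (n : ℝ) ^ (-g n)

/-!
Two probability vectors on `{0, …, 4d² + 1}` with the same first `d` moments can be chosen so that
one has no mass at `0` and the other has large mass there. Give every element of `[D]` a random
multiplicity drawn from one of them, send all other users the same filler input, and permute the
users uniformly. Under the first vector all elements occur, under the second a constant fraction
of them is missing, so the two kinds of dataset must be distinguished by any protocol that counts
distinct elements with error `o(D)`.

Replacing the elements one at a time, it suffices to bound the effect of the multiplicity of a
single element. Fix the public string. With respect to the law of the filler messages, the density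
of the transcript, averaged over permutations, expands in elementary symmetric functions of the
centred density `g - 1` of one message of the element, and multiplicity `k` enters the term of
degree `j` only through `k.choose j`. Hence the terms of degree at most `d` cancel by moment
matching. By orthogonality the term of degree `j` among `m` users has norm at most
`√(C ^ j / m.choose j)`, where `C ≈ exp ε` bounds `g`; for `C d⁶ ≪ n` the remaining terms sum to
at most `4⁻ᵈ`.

Approximate privacy gives no pointwise bound on the density. The part of each randomizer that
exceeds `2 exp ε` times the reference randomizer has mass at most `2 δ` on average over the public
string, and moving it to the reference changes output probabilities by at most `2 n δ`.
-/

open scoped NNReal BigOperators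

theorem four_mul_sub_sq_sub_one_ne_zero (i d : ℕ) : 4 * (i - d : ℝ) ^ 2 - 1 ≠ 0 := by
  have : 4 * (i - d : ℤ) ^ 2 - 1 ≠ 0 := by omega
  exact_mod_cast this

open Polynomial in
theorem sum_alternating_choose_mul_slope_sq_eq_zero {d : ℕ} {p : ℝ[X]} (hp : p.natDegree ≤ d) :
    ∑ i ∈ Finset.range (2 * d + 1), (-1) ^ i * ((2 * d).choose i : ℝ) *
      ((p.eval (4 * (i - d : ℝ) ^ 2) - p.eval 1) / (4 * (i - d : ℝ) ^ 2 - 1)) = 0 := by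
  obtain rfl | hd := eq_or_ne d 0
  · rw [Polynomial.eq_C_of_natDegree_le_zero hp]
    simp
  set q : ℝ[X] := (p /ₘ (X - C 1)).comp (C 4 * X ^ 2)
  have eval_q (i : ℕ) : q.eval (-d + i • 1 : ℝ) =
      (p.eval (4 * (i - d : ℝ) ^ 2) - p.eval 1) / (4 * (i - d : ℝ) ^ 2 - 1) := by
    have := congrArg (eval (4 * (i - d : ℝ) ^ 2)) (X_sub_C_mul_divByMonic_eq_sub_modByMonic p 1)
    rw [modByMonic_X_sub_C_eq_C_eval] at this
    simp only [eval_mul, eval_sub, eval_X, eval_C] at this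
    rw [eq_div_iff (four_mul_sub_sq_sub_one_ne_zero i d), ← this, mul_comm]
    simp [q, neg_add_eq_sub]
  have natDegree_q : q.natDegree < 2 * d := by
    rw [natDegree_comp, natDegree_C_mul_X_pow 2 (4 : ℝ) (by norm_num),
      natDegree_divByMonic _ (monic_X_sub_C _), natDegree_X_sub_C]
    lia
  have fwdDiff_q := congrFun (fwdDiff_iter_eq_zero_of_degree_lt natDegree_q) (-d : ℝ)
  rw [fwdDiff_iter_eq_sum_shift] at fwdDiff_q
  refine Eq.trans (Finset.sum_congr rfl fun i hi => ?_) fwdDiff_q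
  have hi : i ≤ 2 * d := Finset.mem_range_succ_iff.1 hi
  have sign : (-1 : ℤ) ^ (2 * d - i) = (-1) ^ i := neg_one_pow_congr (by grind)
  rw [eval_q, zsmul_eq_mul, sign]
  push_cast
  rfl

theorem sum_range_inv_four_mul_sub_sq_sub_one (d n : ℕ) :
    ∑ i ∈ Finset.range n, (4 * (i - d : ℝ) ^ 2 - 1)⁻¹ =
      ((2 * (0 - d : ℝ) - 1)⁻¹ - (2 * (n - d : ℝ) - 1)⁻¹) / 2 := by
  induction n with
  | zero => simp
  | succ n ih =>
    have key := four_mul_sub_sq_sub_one_ne_zero n d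
    have factor : 4 * (n - d : ℝ) ^ 2 - 1 =
        (2 * (n - d : ℝ) - 1) * (2 * ((n + 1 : ℕ) - d : ℝ) - 1) := by
      push_cast; ring
    have ⟨h₁, h₂⟩ := mul_ne_zero_iff.1 (factor ▸ key)
    rw [Finset.sum_range_succ, ih, factor]
    field_simp
    push_cast
    ring

theorem sum_abs_inv_four_mul_sub_sq_sub_one_le_two (d : ℕ) :
    ∑ i ∈ Finset.range (2 * d + 1), |(4 * (i - d : ℝ) ^ 2 - 1)⁻¹| ≤ 2 := by
  have abs_eq (i : ℕ) : |(4 * (i - d : ℝ) ^ 2 - 1)⁻¹| =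
      (4 * (i - d : ℝ) ^ 2 - 1)⁻¹ + if i = d then 2 else 0 := by
    split_ifs with h
    · norm_num [h]
    · have : 1 ≤ (i - d : ℤ) ^ 2 := Int.add_one_le_iff.2 (sq_pos_of_ne_zero (by lia))
      have : (1 : ℝ) ≤ (i - d : ℝ) ^ 2 := by exact_mod_cast this
      rw [abs_of_pos (inv_pos.2 (by linarith)), add_zero]
  simp only [abs_eq, Finset.sum_add_distrib, sum_range_inv_four_mul_sub_sq_sub_one,
    Finset.sum_ite_eq', Finset.mem_range, show d < 2 * d + 1 by lia, if_true]
  have h₁ : (2 * (0 - d : ℝ) - 1)⁻¹ ≤ 0 := inv_nonpos.2 (by linarith [d.cast_nonneg (α := ℝ)])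
  have h₂ : 0 ≤ (2 * ((2 * d + 1 : ℕ) - d : ℝ) - 1)⁻¹ :=
    inv_nonneg.2 (by push_cast; linarith [d.cast_nonneg (α := ℝ)])
  linarith

open Polynomial in
theorem exists_weights_annihilating_slopes (d : ℕ) : ∃ c : Fin (2 * d + 1) → ℝ,
    c ⟨d, by lia⟩ = 1 ∧ ∑ i, |c i| ≤ 2 ∧ ∀ p : ℝ[X], p.natDegree ≤ d →
      ∑ i, c i * (p.eval (4 * (i - d : ℝ) ^ 2) - p.eval 1) = 0 := by
  set c : ℕ → ℝ := fun i => -((-1) ^ (i + d) * ((2 * d).choose i / d.centralBinom)) *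
    (4 * (i - d : ℝ) ^ 2 - 1)⁻¹
  have abs_c_le (i : ℕ) : |c i| ≤ |(4 * (i - d : ℝ) ^ 2 - 1)⁻¹| := by
    have ratio_le : ((2 * d).choose i : ℝ) / d.centralBinom ≤ 1 :=
      div_le_one_of_le₀ (by exact_mod_cast Nat.choose_le_centralBinom i d) (by positivity)
    simp only [c, abs_mul, abs_neg, abs_pow, abs_one, one_pow, one_mul]
    rw [abs_of_nonneg (by positivity)]
    exact mul_le_of_le_one_left (abs_nonneg _) ratio_le
  refine ⟨fun i => c i, ?_, ?_, fun p hp => ?_⟩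
  · have : (d.centralBinom : ℝ) ≠ 0 := by exact_mod_cast Nat.centralBinom_ne_zero _
    simp [c, ← Nat.centralBinom_eq_two_mul_choose, this]
  · rw [← Finset.sum_range fun i => |c i|]
    exact (Finset.sum_le_sum fun i _ => abs_c_le i).trans
      (sum_abs_inv_four_mul_sub_sq_sub_one_le_two d)
  · rw [← Finset.sum_range fun i : ℕ => c i * (p.eval (4 * (i - d : ℝ) ^ 2) - p.eval 1)]
    refine Eq.trans ?_ ((congrArg (-((-1) ^ d / (d.centralBinom : ℝ)) * ·)
      (sum_alternating_choose_mul_slope_sq_eq_zero hp)).trans (mul_zero _))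
    rw [Finset.mul_sum]
    refine Finset.sum_congr rfl fun i _ => ?_
    simp only [c]
    ring

open Polynomial in
theorem exists_signed_weights_annihilating_polynomials (d : ℕ) : ∃ w : Fin (4 * d ^ 2 + 2) → ℝ,
    w 0 = 1 ∧ ∑ k, |w k| ≤ 4 ∧ ∀ p : ℝ[X], p.natDegree ≤ d → ∑ k, w k * p.eval (k : ℝ) = 0 := by
  obtain ⟨c, c_mid, sum_abs_c, sum_c⟩ := exists_weights_annihilating_slopes d
  have node_lt (i : Fin (2 * d + 1)) : 4 * ((i : ℤ) - d).natAbs ^ 2 < 4 * d ^ 2 + 2 := by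
    have : ((i : ℤ) - d).natAbs ^ 2 ≤ d ^ 2 := Nat.pow_le_pow_left (by omega) 2
    omega
  set node : Fin (2 * d + 1) → Fin (4 * d ^ 2 + 2) := fun i => ⟨_, node_lt i⟩
  have node_cast (i) : ((node i : ℕ) : ℝ) = 4 * (i - d : ℝ) ^ 2 := by
    simp [node, Nat.cast_natAbs]
  refine ⟨∑ i, c i • (Pi.single (node i) 1 - Pi.single 1 1), ?_, ?_, fun p hp => ?_⟩
  · have node_eq_zero (i) : 0 = node i ↔ i = ⟨d, by omega⟩ := by
      simp only [node, Fin.ext_iff, Fin.val_zero]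
      simp; omega
    simp [Pi.single_apply, node_eq_zero, c_mid]
  · calc
      _ ≤ ∑ k, ∑ i, |c i| * ((Pi.single (node i) 1 : _ → ℝ) k + (Pi.single 1 1 : _ → ℝ) k) := by
        gcongr with k
        rw [Finset.sum_apply]
        refine (Finset.abs_sum_le_sum_abs _ _).trans (Finset.sum_le_sum fun i _ => ?_)
        rw [Pi.smul_apply, smul_eq_mul, abs_mul, Pi.sub_apply]
        gcongr
        refine (abs_sub _ _).trans_eq ?_
        simp only [Pi.single_apply, apply_ite abs, abs_one, abs_zero]
      _ ≤ 4 := by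
        rw [Finset.sum_comm]
        simp_rw [← Finset.mul_sum, Finset.sum_add_distrib]
        simp [← Finset.sum_mul]
        linarith
  · simp only [Finset.sum_apply, Pi.smul_apply, Pi.sub_apply, smul_eq_mul, Finset.sum_mul]
    rw [Finset.sum_comm, ← sum_c p hp]
    refine Finset.sum_congr rfl fun i _ => ?_
    simp_rw [mul_assoc, ← Finset.mul_sum, sub_mul, Finset.sum_sub_distrib]
    simp [Pi.single_apply, node_cast]

open Polynomial in
theorem exists_stdSimplex_matching_moments (d : ℕ) :
    ∃ u ∈ stdSimplex ℝ (Fin (4 * d ^ 2 + 2)), ∃ v ∈ stdSimplex ℝ (Fin (4 * d ^ 2 + 2)),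
      1 / 2 ≤ u 0 ∧ v 0 = 0 ∧ ∀ j ≤ d, ∑ k, (u k - v k) * ((k : ℕ).choose j : ℝ) = 0 := by
  obtain ⟨w, w_zero, sum_abs_w, sum_w⟩ := exists_signed_weights_annihilating_polynomials d
  have sum_eq_zero : ∑ k, w k = 0 := by simpa using sum_w 1 (by simp)
  set S := ∑ k, (w k)⁺ with hS
  have sum_negPart : ∑ k, (w k)⁻ = S := by
    rw [eq_comm, ← sub_eq_zero, hS, ← Finset.sum_sub_distrib, ← sum_eq_zero]
    simp only [posPart_sub_negPart]
  have S_le : S ≤ 2 := by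
    have : S + S ≤ 4 := by
      nth_rw 2 [← sum_negPart]
      simpa only [hS, ← Finset.sum_add_distrib, posPart_add_negPart] using sum_abs_w
    linarith
  have one_le_S : 1 ≤ S := by
    have := Finset.single_le_sum (f := fun k => (w k)⁺) (fun k _ => posPart_nonneg _)
      (Finset.mem_univ 0)
    simpa [w_zero] using this
  have S_pos : 0 < S := by linarith
  refine ⟨fun k => (w k)⁺ / S, ⟨fun k => by positivity, ?_⟩,
    fun k => (w k)⁻ / S, ⟨fun k => by positivity, ?_⟩, ?_, ?_, fun j hj => ?_⟩
  · rw [← Finset.sum_div, div_self S_pos.ne']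
  · rw [← Finset.sum_div, sum_negPart, div_self S_pos.ne']
  · simp only [w_zero, posPart_of_nonneg (zero_le_one' ℝ)]
    gcongr
  · simp [w_zero]
  · have := sum_w (descPochhammer ℝ j) (by rwa [descPochhammer_natDegree])
    simp only [descPochhammer_eval_eq_descFactorial, Nat.descFactorial_eq_factorial_mul_choose,
      Nat.cast_mul, mul_left_comm _ (j.factorial : ℝ), ← Finset.mul_sum, mul_eq_zero,
      Nat.cast_eq_zero, j.factorial_ne_zero, false_or] at this
    simp only [← sub_div, posPart_sub_negPart, div_mul_eq_mul_div, ← Finset.sum_div, this,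
      zero_div]

theorem abs_sum_mul_le_of_mem_stdSimplex {α : Type*} [Fintype α] {w f : α → ℝ} {η : ℝ}
    (hw : w ∈ stdSimplex ℝ α) (hf : ∀ a, |f a| ≤ η) : |∑ a, w a * f a| ≤ η :=
  calc
    |∑ a, w a * f a| ≤ ∑ a, |w a * f a| := Finset.abs_sum_le_sum_abs _ _
    _ ≤ ∑ a, w a * η := by
      gcongr with a
      rw [abs_mul, abs_of_nonneg (hw.1 a)]
      exact mul_le_mul_of_nonneg_left (hf a) (hw.1 a)
    _ = η := by rw [← Finset.sum_mul, hw.2, one_mul]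

theorem prod_mem_stdSimplex {ι α : Type*} [Fintype ι] [DecidableEq ι] [Fintype α] {w : α → ℝ}
    (hw : w ∈ stdSimplex ℝ α) : (fun N : ι → α => ∏ i, w (N i)) ∈ stdSimplex ℝ (ι → α) :=
  ⟨fun _ => Finset.prod_nonneg fun _ _ => hw.1 _, by simp [← Fintype.prod_sum, hw.2]⟩

theorem abs_sum_prod_sub_prod_mul_le {α : Type*} [Fintype α] {u v : α → ℝ}
    (hu : u ∈ stdSimplex ℝ α) (hv : v ∈ stdSimplex ℝ α) {η : ℝ} {m : ℕ} (Φ : (Fin m → α) → ℝ)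
    (hΦ : ∀ i N, |∑ a, (u a - v a) * Φ (Function.update N i a)| ≤ η) :
    |∑ N : Fin m → α, ((∏ i, u (N i)) - ∏ i, v (N i)) * Φ N| ≤ m * η := by
  have ⟨b⟩ : Nonempty α := by
    by_contra h
    rw [not_nonempty_iff] at h
    simpa using hu.2
  induction m with
  | zero => simp
  | succ m ih =>
    have telescope : ∑ N : Fin (m + 1) → α, ((∏ i, u (N i)) - ∏ i, v (N i)) * Φ N =
        (∑ a, u a * ∑ N : Fin m → α, ((∏ i, u (N i)) - ∏ i, v (N i)) * Φ (Fin.cons a N)) +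
        ∑ N : Fin m → α, (∏ i, v (N i)) * ∑ a, (u a - v a) * Φ (Fin.cons a N) := by
      simp_rw [← Fintype.sum_equiv (Fin.consEquiv fun _ => α) _ _ fun _ => rfl,
        Fintype.sum_prod_type, Finset.mul_sum]
      rw [Finset.sum_comm (s := (Finset.univ : Finset (Fin m → α)))]
      simp_rw [← Finset.sum_add_distrib]
      refine Finset.sum_congr rfl fun a _ => Finset.sum_congr rfl fun N _ => ?_
      simp only [Fin.consEquiv, Equiv.coe_fn_mk, Fin.prod_univ_succ, Fin.cons_zero, Fin.cons_succ]
      ring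
    have tail_le (a : α) :
        |∑ N : Fin m → α, ((∏ i, u (N i)) - ∏ i, v (N i)) * Φ (Fin.cons a N)| ≤ m * η :=
      ih _ fun i N => by simpa only [Fin.cons_update] using hΦ i.succ (Fin.cons a N)
    have head_le (N : Fin m → α) : |∑ a, (u a - v a) * Φ (Fin.cons a N)| ≤ η := by
      simpa using hΦ 0 (Fin.cons b N)
    calc
      _ ≤ m * η + η := by
        rw [telescope]
        exact (abs_add_le _ _).trans (add_le_add (abs_sum_mul_le_of_mem_stdSimplex hu tail_le)
          (abs_sum_mul_le_of_mem_stdSimplex (prod_mem_stdSimplex hv) head_le))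
      _ = _ := by push_cast; ring

theorem sum_abs_sub_le_two_of_mem_stdSimplex {α : Type*} [Fintype α] {u v : α → ℝ}
    (hu : u ∈ stdSimplex ℝ α) (hv : v ∈ stdSimplex ℝ α) : ∑ a, |u a - v a| ≤ 2 :=
  calc
    ∑ a, |u a - v a| ≤ ∑ a, (u a + v a) := Finset.sum_le_sum fun a _ =>
      abs_le.2 ⟨by linarith [hu.1 a, hv.1 a], by linarith [hu.1 a, hv.1 a]⟩
    _ = 2 := by
      rw [Finset.sum_add_distrib, hu.2, hv.2]
      norm_num

section Averages

variable {ι X : Type*}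

theorem card_filter_subset_powersetCard [DecidableEq ι] {S F : Finset ι} (hS : S ⊆ F) {k : ℕ}
    (hk : S.card ≤ k) :
    ((F.powersetCard k).filter (S ⊆ ·)).card = (F.card - S.card).choose (k - S.card) := by
  rw [← Finset.card_sdiff_of_subset hS, ← Finset.card_powersetCard]
  refine Finset.card_nbij' (· \ S) (· ∪ S) (fun T hT => ?_) (fun T hT => ?_) (fun T hT => ?_)
    (fun T hT => ?_) <;> simp only [Finset.coe_filter, Set.mem_ofPred_eq, Finset.mem_coe,
      Finset.mem_powersetCard] at hT ⊢
  · exact ⟨Finset.sdiff_subset_sdiff hT.1.1 le_rfl,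
      by rw [Finset.card_sdiff_of_subset hT.2, hT.1.2]⟩
  · refine ⟨⟨Finset.union_subset (hT.1.trans Finset.sdiff_subset) hS, ?_⟩,
      Finset.subset_union_right⟩
    rw [Finset.card_union_of_disjoint (Finset.sdiff_disjoint.mono_left hT.1), hT.2,
      Nat.sub_add_cancel hk]
  · exact Finset.sdiff_union_of_subset hT.2
  · exact Finset.union_sdiff_cancel_right (Finset.sdiff_disjoint.mono_left hT.1)

theorem sum_powersetCard_sum_powersetCard {R : Type*} [Semiring R] (F : Finset ι)
    (a : Finset ι → R) {j k : ℕ} (hjk : j ≤ k) :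
    ∑ T ∈ F.powersetCard k, ∑ S ∈ T.powersetCard j, a S =
      (F.card - j).choose (k - j) * ∑ S ∈ F.powersetCard j, a S := by
  classical
  rw [Finset.sum_comm' (t' := F.powersetCard j) (s' := fun S => (F.powersetCard k).filter (S ⊆ ·)),
    Finset.mul_sum]
  · refine Finset.sum_congr rfl fun S hS => ?_
    obtain ⟨hSF, rfl⟩ := Finset.mem_powersetCard.1 hS
    rw [Finset.sum_const, card_filter_subset_powersetCard hSF hjk, nsmul_eq_mul]
  · intro T S
    simp only [Finset.mem_powersetCard, Finset.mem_filter]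
    exact ⟨fun ⟨⟨hT, hk⟩, hS, hj⟩ => ⟨⟨⟨hT, hk⟩, hS⟩, hS.trans hT, hj⟩,
      fun ⟨⟨hT, hS⟩, _, hj⟩ => ⟨hT, hS, hj⟩⟩

theorem expect_powersetCard_sum_powersetCard {𝕜 : Type*} [Field 𝕜] [CharZero 𝕜] (F : Finset ι)
    (a : Finset ι → 𝕜) {j k : ℕ} (hk : k ≤ F.card) :
    𝔼 T ∈ F.powersetCard k, ∑ S ∈ T.powersetCard j, a S =
      k.choose j * 𝔼 S ∈ F.powersetCard j, a S := by
  obtain hkj | hjk := lt_or_ge k j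
  · rw [Nat.choose_eq_zero_of_lt hkj, Nat.cast_zero, zero_mul]
    refine Finset.expect_eq_zero fun T hT => ?_
    rw [Finset.powersetCard_eq_empty.2 ((Finset.mem_powersetCard.1 hT).2.trans_lt hkj),
      Finset.sum_empty]
  · have choose_ne_zero {i : ℕ} (hi : i ≤ F.card) : (F.card.choose i : 𝕜) ≠ 0 :=
      Nat.cast_ne_zero.2 (Nat.choose_pos hi).ne'
    have trinomial_revision : (F.card.choose k : 𝕜) * k.choose j =
        F.card.choose j * (F.card - j).choose (k - j) := by
      exact_mod_cast Nat.choose_mul hjk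
    rw [Finset.expect_eq_sum_div_card, Finset.expect_eq_sum_div_card, Finset.card_powersetCard,
      Finset.card_powersetCard, sum_powersetCard_sum_powersetCard F a hjk, mul_div_assoc',
      div_eq_div_iff (choose_ne_zero hk) (choose_ne_zero (hjk.trans hk))]
    linear_combination -(∑ S ∈ F.powersetCard j, a S) * trinomial_revision

theorem expect_powersetCard_prod_one_add {𝕜 : Type*} [Field 𝕜] [CharZero 𝕜] (F : Finset ι)
    (g : ι → 𝕜) {k n : ℕ} (hk : k ≤ F.card) (hkn : k < n) :
    𝔼 T ∈ F.powersetCard k, ∏ i ∈ T, (1 + g i) =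
      ∑ j ∈ Finset.range n, k.choose j * 𝔼 S ∈ F.powersetCard j, ∏ i ∈ S, g i := by
  classical
  simp_rw [← expect_powersetCard_sum_powersetCard F _ hk, Finset.prod_one_add]
  rw [← Finset.expect_sum_comm]
  refine Finset.expect_congr rfl fun T hT => ?_
  obtain ⟨-, rfl⟩ := Finset.mem_powersetCard.1 hT
  rw [Finset.sum_powerset]
  refine Finset.sum_subset (Finset.range_mono hkn) fun j _ hj => ?_
  rw [Finset.powersetCard_eq_empty.2 (by simpa using hj), Finset.sum_empty]

theorem exists_perm_mem_iff_mem {S T F : Finset ι} (hS : S ⊆ F) (hT : T ⊆ F)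
    (hST : S.card = T.card) :
    ∃ τ : Equiv.Perm ι, (∀ j, τ j ∈ T ↔ j ∈ S) ∧ ∀ j ∉ F, τ j = j := by
  classical
  have card_eq {U : Finset ι} (hU : U ⊆ F) : Fintype.card {j : F // ↑j ∈ U} = U.card :=
    (Fintype.card_congr (Equiv.subtypeSubtypeEquivSubtype (@hU))).trans (Fintype.card_coe U)
  set e : {j : F // ↑j ∈ S} ≃ {j : F // ↑j ∈ T} :=
    Fintype.equivOfCardEq (by rw [card_eq hS, card_eq hT, hST])
  refine ⟨Equiv.Perm.ofSubtype e.extendSubtype, fun j => ?_,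
    fun j hj => Equiv.Perm.ofSubtype_apply_of_not_mem _ hj⟩
  by_cases hj : j ∈ F
  · rw [Equiv.Perm.ofSubtype_apply_of_mem _ hj]
    by_cases hjS : j ∈ S
    · simpa [hjS] using Equiv.extendSubtype_mem e ⟨j, hj⟩ hjS
    · simpa [hjS] using Equiv.extendSubtype_not_mem e ⟨j, hj⟩ hjS
  · rw [Equiv.Perm.ofSubtype_apply_of_not_mem _ hj]
    exact iff_of_false (fun h => hj (hT h)) fun h => hj (hS h)

theorem expect_perm_piecewise [Fintype ι] [DecidableEq ι] (Φ : (ι → X) → ℝ) {x : ι → X}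
    {a c : X} {F T : Finset ι} (hF : ∀ j ∈ F, x j = a) (hT : T ⊆ F) :
    𝔼 σ : Equiv.Perm ι, Φ (T.piecewise (fun _ => c) x ∘ σ) =
      𝔼 σ : Equiv.Perm ι, 𝔼 S ∈ F.powersetCard T.card, Φ (S.piecewise (fun _ => c) x ∘ σ) := by
  rw [Finset.expect_comm, ← Finset.expect_const
    (Finset.powersetCard_nonempty.2 (Finset.card_le_card hT)) (𝔼 σ : Equiv.Perm ι, _)]
  refine Finset.expect_congr rfl fun S hS => ?_
  obtain ⟨hSF, hST⟩ := Finset.mem_powersetCard.1 hS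
  obtain ⟨τ, mem_iff, fix⟩ := exists_perm_mem_iff_mem hSF hT hST
  have comp_eq : T.piecewise (fun _ => c) x ∘ τ = S.piecewise (fun _ => c) x := by
    funext j
    by_cases hj : j ∈ S
    · simp [hj, mem_iff]
    · have : x (τ j) = x j := by
        by_cases hj : j ∈ F <;> by_cases hτj : τ j ∈ F
        · rw [hF j hj, hF _ hτj]
        · rw [τ.injective (fix _ hτj)]
        all_goals rw [fix j hj]
      simp [hj, mem_iff, this]
  refine Fintype.expect_equiv (Equiv.mulLeft τ⁻¹) _ _ fun σ => ?_
  rw [← comp_eq, Function.comp_assoc, ← Equiv.Perm.coe_mul, Equiv.coe_mulLeft, mul_inv_cancel_left]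

end Averages

section ProductMeasures

variable {ι M : Type*} [Fintype ι] [MeasurableSpace M] {ρ : ι → Measure M}

theorem pi_measure_mono {μ ν : ι → Measure M} [∀ i, SigmaFinite (μ i)] (h : ∀ i, μ i ≤ ν i) :
    Measure.pi μ ≤ Measure.pi ν := by
  have outer_le : (Measure.pi μ).toOuterMeasure ≤
      OuterMeasure.pi fun i => (ν i).toOuterMeasure := by
    rw [OuterMeasure.le_pi]
    intro s _
    rw [Measure.coe_toOuterMeasure, Measure.pi_pi]
    exact Finset.prod_le_prod' fun i _ => h i _
  refine Measure.le_iff.2 fun s hs => ?_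
  conv_rhs => rw [Measure.pi, toMeasure_apply _ _ hs]
  exact outer_le s

theorem lintegral_fintype_prod_eq_prod [∀ i, IsProbabilityMeasure (ρ i)] {f : ι → M → ℝ≥0∞}
    (hf : ∀ i, Measurable (f i)) :
    ∫⁻ y, ∏ i, f i (y i) ∂Measure.pi ρ = ∏ i, ∫⁻ m, f i m ∂ρ i := by
  have indep : iIndepFun (fun i (y : ι → M) => f i (y i)) (Measure.pi ρ) :=
    (iIndepFun_pi (X := fun _ m => m) fun _ => aemeasurable_id).comp f hf
  rw [lintegral_prod_eq_prod_lintegral_of_indepFun Finset.univ _ indep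
    fun i => (hf i).comp (measurable_pi_apply i)]
  exact Finset.prod_congr rfl fun i _ => (measurePreserving_eval ρ i).lintegral_comp (hf i)

theorem pi_withDensity [∀ i, IsProbabilityMeasure (ρ i)] {f : ι → M → ℝ≥0∞}
    (hf : ∀ i, Measurable (f i)) [∀ i, SigmaFinite ((ρ i).withDensity (f i))] :
    Measure.pi (fun i => (ρ i).withDensity (f i)) =
      (Measure.pi ρ).withDensity fun y => ∏ i, f i (y i) := by
  refine Measure.pi_eq fun s hs => ?_
  have hs_pi := MeasurableSet.univ_pi hs
  simp_rw [withDensity_apply _ hs_pi, withDensity_apply _ (hs _), ← lintegral_indicator hs_pi,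
    ← lintegral_indicator (hs _)]
  rw [← lintegral_fintype_prod_eq_prod fun i => (hf i).indicator (hs i)]
  refine lintegral_congr fun y => ?_
  by_cases hy : y ∈ Set.univ.pi s
  · rw [Set.indicator_of_mem hy]
    exact Finset.prod_congr rfl fun i _ => (Set.indicator_of_mem (hy i trivial) _).symm
  · obtain ⟨i, hi⟩ : ∃ i, y i ∉ s i := by simpa using hy
    rw [Set.indicator_of_notMem hy, Finset.prod_eq_zero (Finset.mem_univ i)]
    exact Set.indicator_of_notMem hi _

theorem integral_pi_piecewise_withDensity [DecidableEq ι] [∀ i, IsProbabilityMeasure (ρ i)]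
    {P : Measure M} {f : M → ℝ≥0} (hf : Measurable f)
    [SigmaFinite (P.withDensity fun m => f m)] {T : Finset ι} (hT : ∀ j ∈ T, ρ j = P)
    (φ : (ι → M) → ℝ) :
    ∫ y, φ y ∂Measure.pi (T.piecewise (fun _ => P.withDensity fun m => f m) ρ) =
      ∫ y, φ y * ∏ j ∈ T, (f (y j) : ℝ) ∂Measure.pi ρ := by
  set h : ι → M → ℝ≥0∞ := fun i m => if i ∈ T then f m else 1
  have piecewise_eq : T.piecewise (fun _ => P.withDensity fun m => f m) ρ =
      fun i => (ρ i).withDensity (h i) := by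
    funext i
    by_cases hi : i ∈ T
    · simp [h, hi, hT i hi]
    · simp [h, hi]
  have sigmaFinite (i) : SigmaFinite ((ρ i).withDensity (h i)) := by
    rw [← congrFun piecewise_eq i, Finset.piecewise]
    split_ifs <;> infer_instance
  have measurable_h (i) : Measurable (h i) := by
    simp only [h]
    split_ifs <;> fun_prop
  have prod_h : (fun y : ι → M => ∏ i, h i (y i)) =
      fun y => ((∏ j ∈ T, f (y j) : ℝ≥0) : ℝ≥0∞) := by
    funext y
    rw [ENNReal.ofNNReal_finsetProd, Finset.prod_ite_mem, Finset.univ_inter]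
  rw [piecewise_eq, pi_withDensity measurable_h, prod_h,
    integral_withDensity_eq_integral_smul (by fun_prop)]
  simp only [NNReal.smul_def, NNReal.coe_prod, smul_eq_mul, mul_comm]

theorem integrable_prod_comp_eval [∀ i, IsProbabilityMeasure (ρ i)] {g : M → ℝ} {T : Finset ι}
    (hg : ∀ j ∈ T, Integrable g (ρ j)) :
    Integrable (fun y => ∏ j ∈ T, g (y j)) (Measure.pi ρ) := by
  classical
  have (y : ι → M) : ∏ j ∈ T, g (y j) = ∏ j, if j ∈ T then g (y j) else 1 := by
    rw [Finset.prod_ite_mem, Finset.univ_inter]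
  simp_rw [this]
  refine Integrable.fintype_prod (f := fun j m => if j ∈ T then g m else 1) fun j => ?_
  split_ifs with hj
  exacts [hg j hj, integrable_const 1]

theorem memLp_two_prod_comp_eval [∀ i, IsProbabilityMeasure (ρ i)] {g : M → ℝ} {T : Finset ι}
    (hg : ∀ j ∈ T, MemLp g 2 (ρ j)) :
    MemLp (fun y => ∏ j ∈ T, g (y j)) 2 (Measure.pi ρ) := by
  have integrable_g (j) (hj : j ∈ T) : Integrable g (ρ j) := (hg j hj).integrable one_le_two
  refine (memLp_two_iff_integrable_sq (integrable_prod_comp_eval integrable_g).1).2 ?_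
  simp_rw [← Finset.prod_pow]
  exact integrable_prod_comp_eval fun j hj => (hg j hj).integrable_sq

theorem integral_prod_mul_prod_comp_eval [DecidableEq ι] [∀ i, IsProbabilityMeasure (ρ i)]
    {P : Measure M} {g : M → ℝ} (hg : ∫ m, g m ∂P = 0) {S T : Finset ι} (hS : ∀ j ∈ S, ρ j = P)
    (hT : ∀ j ∈ T, ρ j = P) :
    ∫ y, (∏ j ∈ S, g (y j)) * ∏ j ∈ T, g (y j) ∂Measure.pi ρ =
      if S = T then (∫ m, g m ^ 2 ∂P) ^ S.card else 0 := by
  set h : ι → M → ℝ := fun j m => (if j ∈ S then g m else 1) * (if j ∈ T then g m else 1)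
  have prod_eq (y : ι → M) : (∏ j ∈ S, g (y j)) * ∏ j ∈ T, g (y j) = ∏ j, h j (y j) := by
    simp only [h]
    rw [Finset.prod_mul_distrib, Finset.prod_ite_mem, Finset.prod_ite_mem, Finset.univ_inter,
      Finset.univ_inter]
  simp_rw [prod_eq]
  rw [integral_fintype_prod_eq_prod (𝕜 := ℝ)]
  split_ifs with hST
  · subst hST
    rw [← Finset.prod_const, ← Finset.univ_inter S, ← Finset.prod_ite_mem]
    refine Finset.prod_congr rfl fun j _ => ?_
    by_cases hj : j ∈ S
    · simp [h, hj, hS j hj, sq]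
    · simp [h, hj]
  · obtain ⟨j, hj⟩ : ∃ j, ¬(j ∈ S ↔ j ∈ T) := by
      by_contra! hST'
      exact hST (Finset.ext hST')
    refine Finset.prod_eq_zero (Finset.mem_univ j) ?_
    by_cases hjS : j ∈ S
    · have hjT : j ∉ T := by tauto
      simp [h, hjS, hjT, hS j hjS, hg]
    · have hjT : j ∈ T := by tauto
      simp [h, hjS, hjT, hT j hjT, hg]

end ProductMeasures

theorem abs_integral_mul_le_sqrt_integral_sq {Ω : Type*} [MeasurableSpace Ω] {μ : Measure Ω}
    [IsProbabilityMeasure μ] {φ h : Ω → ℝ} (hφ : AEStronglyMeasurable φ μ) (hφ_le : ∀ y, |φ y| ≤ 1)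
    (hh : MemLp h 2 μ) : |∫ y, φ y * h y ∂μ| ≤ √(∫ y, h y ^ 2 ∂μ) := by
  have hφh : MemLp (fun y => φ y * h y) 2 μ := hh.mono (hφ.mul hh.1) <| .of_forall fun y => by
    rw [norm_mul]
    exact mul_le_of_le_one_left (norm_nonneg _) (hφ_le y)
  have variance_eq := variance_eq_sub hφh
  refine Real.abs_le_sqrt ?_
  calc
    _ ≤ ∫ y, (φ y * h y) ^ 2 ∂μ := by
      have := variance_nonneg (fun y => φ y * h y) μ
      rw [variance_eq, sub_nonneg] at this
      exact this
    _ ≤ ∫ y, h y ^ 2 ∂μ := integral_mono hφh.integrable_sq hh.integrable_sq fun y => by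
      rw [mul_pow]
      exact mul_le_of_le_one_left (sq_nonneg _) ((sq_le_one_iff_abs_le_one _).2 (hφ_le y))

theorem integral_expect {Ω κ : Type*} [MeasurableSpace Ω] {μ : Measure Ω} {s : Finset κ}
    {f : κ → Ω → ℝ} (hf : ∀ i ∈ s, Integrable (f i) μ) :
    ∫ y, 𝔼 i ∈ s, f i y ∂μ = 𝔼 i ∈ s, ∫ y, f i y ∂μ := by
  simp_rw [Finset.expect_eq_sum_div_card]
  rw [integral_div, integral_finsetSum s hf]

section UStatistic

variable {ι M : Type*}

/-- The degree `j` U-statistic of the observations `y i`, `i ∈ F`, with the product kernel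
`g ⊗ ⋯ ⊗ g`: the average of `∏ i ∈ S, g (y i)` over the `j`-element subsets `S` of `F`. -/
noncomputable def uStat (F : Finset ι) (g : M → ℝ) (j : ℕ) (y : ι → M) : ℝ :=
  𝔼 S ∈ F.powersetCard j, ∏ i ∈ S, g (y i)

variable [Fintype ι] [MeasurableSpace M] {ρ : ι → Measure M} [∀ i, IsProbabilityMeasure (ρ i)]
  {P : Measure M} {F : Finset ι}

theorem memLp_two_uStat (hF : ∀ j ∈ F, ρ j = P) {g : M → ℝ} (hg : MemLp g 2 P) (j : ℕ) :
    MemLp (uStat F g j) 2 (Measure.pi ρ) := by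
  have memLp_sum := memLp_finsetSum (F.powersetCard j) fun S hS =>
    memLp_two_prod_comp_eval (g := g) (ρ := ρ) fun i hi =>
      (hF i ((Finset.mem_powersetCard.1 hS).1 hi)) ▸ hg
  have uStat_eq : uStat F g j = fun y =>
      ((F.powersetCard j).card : ℝ)⁻¹ * ∑ S ∈ F.powersetCard j, ∏ i ∈ S, g (y i) := by
    funext y
    rw [uStat, Finset.expect_eq_sum_div_card, div_eq_inv_mul]
  rw [uStat_eq]
  exact memLp_sum.const_mul _

theorem integral_prod_mul_uStat (hF : ∀ j ∈ F, ρ j = P) {g : M → ℝ} (hg : MemLp g 2 P)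
    (hg_zero : ∫ m, g m ∂P = 0) {S : Finset ι} (hS : S ⊆ F) :
    ∫ y, (∏ i ∈ S, g (y i)) * uStat F g S.card y ∂Measure.pi ρ =
      (∫ m, g m ^ 2 ∂P) ^ S.card / F.card.choose S.card := by
  classical
  have eq_P {T : Finset ι} (hT : T ∈ F.powersetCard S.card) (i) (hi : i ∈ T) : ρ i = P :=
    hF i ((Finset.mem_powersetCard.1 hT).1 hi)
  have hS : S ∈ F.powersetCard S.card := Finset.mem_powersetCard.2 ⟨hS, rfl⟩
  have memLp_prod {T : Finset ι} (hT : T ∈ F.powersetCard S.card) :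
      MemLp (fun y => ∏ i ∈ T, g (y i)) 2 (Measure.pi ρ) :=
    memLp_two_prod_comp_eval fun i hi => eq_P hT i hi ▸ hg
  simp_rw [uStat, Finset.mul_expect]
  have integrable_mul (T) (hT : T ∈ F.powersetCard S.card) :
      Integrable (fun y => (∏ i ∈ S, g (y i)) * ∏ i ∈ T, g (y i)) (Measure.pi ρ) :=
    (memLp_prod hS).integrable_mul (memLp_prod hT)
  rw [integral_expect integrable_mul,
    Finset.expect_congr rfl fun T hT =>
      integral_prod_mul_prod_comp_eval hg_zero (eq_P hS) (eq_P hT),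
    Finset.expect_eq_sum_div_card, Finset.sum_ite_eq, if_pos hS, Finset.card_powersetCard]

theorem integral_uStat_sq (hF : ∀ j ∈ F, ρ j = P) {g : M → ℝ} (hg : MemLp g 2 P)
    (hg_zero : ∫ m, g m ∂P = 0) (j : ℕ) :
    ∫ y, uStat F g j y ^ 2 ∂Measure.pi ρ = (∫ m, g m ^ 2 ∂P) ^ j / F.card.choose j := by
  have integrable_mul {S : Finset ι} (hS : S ∈ F.powersetCard j) :
      Integrable (fun y => (∏ i ∈ S, g (y i)) * uStat F g j y) (Measure.pi ρ) :=
    MemLp.integrable_mul (memLp_two_prod_comp_eval fun i hi =>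
      hF i ((Finset.mem_powersetCard.1 hS).1 hi) ▸ hg) (memLp_two_uStat hF hg j)
  have expand (y : ι → M) :
      uStat F g j y ^ 2 = 𝔼 S ∈ F.powersetCard j, (∏ i ∈ S, g (y i)) * uStat F g j y := by
    rw [sq, ← Finset.expect_mul, uStat]
  simp_rw [expand]
  rw [integral_expect fun S hS => integrable_mul hS]
  obtain hF_empty | hF_nonempty := (F.powersetCard j).eq_empty_or_nonempty
  · rw [hF_empty, Finset.expect_empty, ← Finset.card_powersetCard, hF_empty]
    simp
  · rw [← Finset.expect_const hF_nonempty (_ / _ : ℝ)]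
    refine Finset.expect_congr rfl fun S hS => ?_
    obtain ⟨hSF, rfl⟩ := Finset.mem_powersetCard.1 hS
    exact integral_prod_mul_uStat hF hg hg_zero hSF

variable {f : M → ℝ≥0}

section

variable [IsProbabilityMeasure P] {C : ℝ≥0}

theorem memLp_density (hf : Measurable f) (hfC : ∀ m, f m ≤ C) (p : ℝ≥0∞) :
    MemLp (fun m => (f m : ℝ)) p P :=
  .of_bound (by fun_prop) C (.of_forall fun m => by simpa using hfC m)

theorem memLp_density_sub_one (hf : Measurable f) (hfC : ∀ m, f m ≤ C) (p : ℝ≥0∞) :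
    MemLp (fun m => (f m - 1 : ℝ)) p P :=
  (memLp_density hf hfC p).sub (memLp_const 1)

theorem expect_integral_pi_piecewise [DecidableEq ι] (hf : Measurable f) (hfC : ∀ m, f m ≤ C)
    (hF : ∀ j ∈ F, ρ j = P) {φ : (ι → M) → ℝ} (hφ : Measurable φ) (hφ_le : ∀ y, |φ y| ≤ 1)
    {k n : ℕ} (hk : k ≤ F.card) (hkn : k < n) :
    𝔼 T ∈ F.powersetCard k,
        ∫ y, φ y ∂Measure.pi (T.piecewise (fun _ => P.withDensity fun m => f m) ρ) =
      ∑ j ∈ Finset.range n,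
        k.choose j * ∫ y, φ y * uStat F (fun m => f m - 1) j y ∂Measure.pi ρ := by
  have hT {T} (hT : T ∈ F.powersetCard k) (j) (hj : j ∈ T) : ρ j = P :=
    hF j ((Finset.mem_powersetCard.1 hT).1 hj)
  have integrable_f {μ : Measure M} (hμ : μ = P) : Integrable (fun m => (f m : ℝ)) μ :=
    hμ ▸ (memLp_density hf hfC 1).integrable le_rfl
  have integrable_prod {T} (hT' : T ∈ F.powersetCard k) :
      Integrable (fun y => φ y * ∏ j ∈ T, (f (y j) : ℝ)) (Measure.pi ρ) :=
    (integrable_prod_comp_eval fun j hj => integrable_f (hT hT' j hj)).bdd_mul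
      hφ.aestronglyMeasurable (.of_forall hφ_le)
  have integrable_uStat (j : ℕ) :
      Integrable (fun y => φ y * uStat F (fun m => f m - 1 : M → ℝ) j y) (Measure.pi ρ) :=
    ((memLp_two_uStat hF (memLp_density_sub_one hf hfC 2) j).integrable one_le_two).bdd_mul
      hφ.aestronglyMeasurable (.of_forall hφ_le)
  calc
    _ = 𝔼 T ∈ F.powersetCard k, ∫ y, φ y * ∏ j ∈ T, (f (y j) : ℝ) ∂Measure.pi ρ :=
      Finset.expect_congr rfl fun T hT' => integral_pi_piecewise_withDensity hf (hT hT') φ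
    _ = ∫ y, ∑ j ∈ Finset.range n,
        k.choose j * (φ y * uStat F (fun m => f m - 1) j y) ∂Measure.pi ρ := by
      rw [← integral_expect fun T hT' => integrable_prod hT']
      refine integral_congr_ae (.of_forall fun y => ?_)
      have := expect_powersetCard_prod_one_add F (fun i => (f (y i) - 1 : ℝ)) hk hkn
      simp only [add_sub_cancel] at this
      simp only [← Finset.mul_expect, this, Finset.mul_sum, uStat, mul_left_comm]
    _ = _ := by
      rw [integral_finsetSum _ fun j _ => (integrable_uStat j).const_mul _]
      simp_rw [integral_const_mul]

end

variable [IsProbabilityMeasure (P.withDensity fun m => f m)]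

theorem integral_density_eq_one (hf : Measurable f) : ∫ m, (f m : ℝ) ∂P = 1 := by
  have := integral_withDensity_eq_integral_smul hf (fun _ => (1 : ℝ)) (μ := P)
  simpa [NNReal.smul_def] using this.symm

variable [IsProbabilityMeasure P] {C : ℝ≥0}

theorem integral_density_sub_one_eq_zero (hf : Measurable f) (hfC : ∀ m, f m ≤ C) :
    ∫ m, (f m - 1 : ℝ) ∂P = 0 := by
  rw [integral_sub ((memLp_density hf hfC 1).integrable le_rfl) (integrable_const 1),
    integral_density_eq_one hf]
  simp

theorem integral_density_sub_one_sq_le (hf : Measurable f) (hfC : ∀ m, f m ≤ C) :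
    ∫ m, (f m - 1 : ℝ) ^ 2 ∂P ≤ C :=
  have integrable_f : Integrable (fun m => (f m : ℝ)) P :=
    (memLp_density hf hfC 1).integrable le_rfl
  have integrable_bound : Integrable (fun m => ((C - 2) * f m + 1 : ℝ)) P :=
    (integrable_f.const_mul _).add (integrable_const 1)
  calc
    ∫ m, (f m - 1 : ℝ) ^ 2 ∂P ≤ ∫ m, ((C - 2) * f m + 1 : ℝ) ∂P := by
      refine integral_mono (memLp_density_sub_one hf hfC 2).integrable_sq integrable_bound
        fun m => ?_
      have : (f m : ℝ) ≤ C := hfC m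
      dsimp only
      nlinarith [(f m).coe_nonneg]
    _ = C - 1 := by
      rw [integral_add (integrable_f.const_mul _) (integrable_const 1), integral_const_mul,
        integral_density_eq_one hf]
      simp only [integral_const, probReal_univ, one_smul]
      ring
    _ ≤ C := by linarith

theorem abs_integral_mul_uStat_le (hf : Measurable f) (hfC : ∀ m, f m ≤ C)
    (hF : ∀ j ∈ F, ρ j = P) {φ : (ι → M) → ℝ} (hφ : Measurable φ) (hφ_le : ∀ y, |φ y| ≤ 1)
    (j : ℕ) :
    |∫ y, φ y * uStat F (fun m => f m - 1) j y ∂Measure.pi ρ| ≤ √(C ^ j / F.card.choose j) := by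
  have memLp_g := memLp_density_sub_one hf hfC 2 (P := P)
  refine (abs_integral_mul_le_sqrt_integral_sq hφ.aestronglyMeasurable hφ_le
    (memLp_two_uStat hF memLp_g j)).trans ?_
  rw [integral_uStat_sq hF memLp_g (integral_density_sub_one_eq_zero hf hfC)]
  gcongr
  exact integral_density_sub_one_sq_le hf hfC

theorem abs_sum_mul_expect_integral_le [DecidableEq ι] (hf : Measurable f) (hfC : ∀ m, f m ≤ C)
    (hF : ∀ j ∈ F, ρ j = P) {φ : (ι → M) → ℝ} (hφ : Measurable φ) (hφ_le : ∀ y, |φ y| ≤ 1)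
    {n : ℕ} (hn : n ≤ F.card + 1) (w : Fin n → ℝ) :
    |∑ k, w k * 𝔼 T ∈ F.powersetCard k,
        ∫ y, φ y ∂Measure.pi (T.piecewise (fun _ => P.withDensity fun m => f m) ρ)| ≤
      ∑ j ∈ Finset.range n,
        |∑ k, w k * ((k : ℕ).choose j : ℝ)| * √(C ^ j / F.card.choose j) := by
  simp_rw [fun k : Fin n => expect_integral_pi_piecewise hf hfC hF hφ hφ_le (k := k) (by lia)
    k.isLt, Finset.mul_sum]
  rw [Finset.sum_comm]
  refine (Finset.abs_sum_le_sum_abs _ _).trans (Finset.sum_le_sum fun j _ => ?_)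
  simp_rw [← mul_assoc, ← Finset.sum_mul, abs_mul]
  gcongr
  exact abs_integral_mul_uStat_le hf hfC hF hφ hφ_le j

end UStatistic

theorem lintegral_pi_le_add_sum {ι M : Type*} [Fintype ι] [MeasurableSpace M]
    {μ ν : ι → Measure M} [∀ i, IsProbabilityMeasure (μ i)] {s : ι → Set M}
    (hs : ∀ i, MeasurableSet (s i)) (h : ∀ i, (μ i).restrict (s i) ≤ ν i)
    {φ : (ι → M) → ℝ≥0∞} (hφ : ∀ y, φ y ≤ 1) :
    ∫⁻ y, φ y ∂Measure.pi μ ≤ ∫⁻ y, φ y ∂Measure.pi ν + ∑ i, μ i (s i)ᶜ := by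
  rw [← lintegral_add_compl φ (MeasurableSet.univ_pi hs)]
  refine add_le_add ?_ ?_
  · rw [Measure.restrict_pi_pi]
    exact lintegral_mono' (pi_measure_mono h) le_rfl
  calc
    ∫⁻ y in (Set.univ.pi s)ᶜ, φ y ∂Measure.pi μ ≤ Measure.pi μ (Set.univ.pi s)ᶜ :=
      (lintegral_mono hφ).trans_eq (by rw [setLIntegral_const, one_mul])
    _ = Measure.pi μ (⋃ i, Function.eval i ⁻¹' (s i)ᶜ) := by
      rw [Set.pi_def, Set.compl_iInter₂]
      simp
    _ ≤ ∑ i, Measure.pi μ (Function.eval i ⁻¹' (s i)ᶜ) := measure_iUnion_fintype_le _ _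
    _ = ∑ i, μ i (s i)ᶜ := Finset.sum_congr rfl fun i _ =>
      (measurePreserving_eval μ i).measure_preimage (hs i).compl.nullMeasurableSet

section Domination

variable {M : Type*} [MeasurableSpace M] {P Q : Measure M}

theorem exists_density_of_le_smul [IsFiniteMeasure P] {C : ℝ≥0} (h : Q ≤ C • P) :
    ∃ f : M → ℝ≥0, Measurable f ∧ (∀ m, f m ≤ C) ∧ Q = P.withDensity fun m => f m := by
  have density_eq : P.withDensity (Q.rnDeriv P) = Q := by
    have : IsFiniteMeasure Q := isFiniteMeasure_of_le _ h
    exact Measure.withDensity_rnDeriv_eq _ _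
      (Measure.absolutelyContinuous_of_le_smul h)
  have rnDeriv_le : Q.rnDeriv P ≤ᵐ[P] fun _ => (C : ℝ≥0∞) := by
    refine ae_le_of_forall_setLIntegral_le_of_sigmaFinite (Q.measurable_rnDeriv P) fun t ht _ => ?_
    rw [← withDensity_apply _ ht, density_eq, setLIntegral_const]
    exact h t
  refine ⟨fun m => (min (Q.rnDeriv P m) C).toNNReal, by fun_prop, fun m => ?_, ?_⟩
  · simpa using ENNReal.toNNReal_mono ENNReal.coe_ne_top (min_le_right (Q.rnDeriv P m) C)
  · conv_lhs => rw [← density_eq]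
    refine withDensity_congr_ae ?_
    filter_upwards [rnDeriv_le] with m hm
    rw [min_eq_left hm, ENNReal.coe_toNNReal (ne_top_of_le_ne_top ENNReal.coe_ne_top hm)]

theorem exists_dominated_truncation (P Q : Measure M) [IsProbabilityMeasure P]
    [IsProbabilityMeasure Q] (c : ℝ≥0) :
    ∃ (s : Set M) (Q' : ProbabilityMeasure M), MeasurableSet s ∧ Q' ≤ (c + 1) • P ∧
      Q.restrict s ≤ Q' ∧ c * P sᶜ ≤ Q sᶜ := by
  obtain ⟨s, hs, le_on, ge_on⟩ := hahn_decomposition (c • P) Q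
  have restrict_le : Q.restrict s ≤ c • P := Measure.le_iff.2 fun t ht => by
    rw [Measure.restrict_apply ht]
    exact (le_on _ (ht.inter hs) Set.inter_subset_right).trans (measure_mono Set.inter_subset_left)
  have isProbabilityMeasure : IsProbabilityMeasure (Q.restrict s + Q sᶜ • P) :=
    ⟨by simp [measure_add_measure_compl hs]⟩
  refine ⟨s, ⟨Q.restrict s + Q sᶜ • P, isProbabilityMeasure⟩, hs, ?_,
    Measure.le_add_right le_rfl, ge_on _ hs.compl subset_rfl⟩
  rw [add_smul]
  refine add_le_add restrict_le (Measure.le_iff'.2 fun t => ?_)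
  rw [one_smul]
  exact mul_le_of_le_one_left' prob_le_one

end Domination

namespace PublicCoinLocalProtocol

variable {n : ℕ} {X : Type} {M : Type u} [MeasurableSpace M]

theorem output_apply (P : PublicCoinLocalProtocol n X M) (x : Fin n → X) {E : Set ℝ}
    (hE : MeasurableSet E) :
    P.output x E =
      ∑' a, P.pub a * ∫⁻ y, P.A a y E ∂Measure.pi fun i => (P.R a (x i) : Measure M) := by
  rw [output, Measure.sum_apply _ hE]
  refine tsum_congr fun a => ?_
  rw [Measure.smul_apply, Measure.bind_apply hE (P.A a).aemeasurable, smul_eq_mul]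

/-- The randomizer on every input is dominated by `C` times the randomizer on the reference input
`z`: pure differential privacy, in one direction and up to a constant. -/
def IsDominated (P : PublicCoinLocalProtocol n X M) (z : X) (C : ℝ≥0) : Prop :=
  ∀ a i, (P.R a i : Measure M) ≤ C • (P.R a z : Measure M)

theorem viewProb_le_one (P : PublicCoinLocalProtocol n X M) (x : X) (S : List Bool → Set M) :
    P.viewProb x S ≤ 1 := by
  rw [← P.pub.tsum_coe]
  exact ENNReal.tsum_le_tsum fun a => mul_le_of_le_one_right' prob_le_one

theorem IsLocallyDP.viewProb_le_of_forall_two_mul_exp_mul_le {P : PublicCoinLocalProtocol n X M}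
    {ε δ : ℝ} (hP : P.IsLocallyDP ε δ) {i z : X} {S : List Bool → Set M}
    (hS : ∀ a, MeasurableSet (S a))
    (h : ∀ a, 2 * ENNReal.ofReal (Real.exp ε) * (P.R a z : Measure M) (S a) ≤
      (P.R a i : Measure M) (S a)) :
    P.viewProb i S ≤ ENNReal.ofReal (2 * δ) := by
  have two_mul_le : 2 * ENNReal.ofReal (Real.exp ε) * P.viewProb z S ≤ P.viewProb i S := by
    rw [viewProb, viewProb, ← ENNReal.tsum_mul_left]
    refine ENNReal.tsum_le_tsum fun a => ?_
    rw [mul_left_comm]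
    exact mul_le_mul_right (h a) _
  have ne_top : P.viewProb i S ≠ ∞ := ne_top_of_le_ne_top ENNReal.one_ne_top (P.viewProb_le_one i S)
  refine (ENNReal.add_le_add_iff_left ne_top).1 ?_
  calc
    P.viewProb i S + P.viewProb i S = 2 * P.viewProb i S := (two_mul _).symm
    _ ≤ 2 * (ENNReal.ofReal (Real.exp ε) * P.viewProb z S + ENNReal.ofReal δ) := by
      gcongr
      exact hP i z S hS
    _ = 2 * ENNReal.ofReal (Real.exp ε) * P.viewProb z S + ENNReal.ofReal (2 * δ) := by
      rw [mul_add, mul_assoc, ENNReal.ofReal_mul zero_le_two, ENNReal.ofReal_ofNat]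
    _ ≤ P.viewProb i S + ENNReal.ofReal (2 * δ) := by gcongr

theorem output_le_output_add_sum_viewProb (P : PublicCoinLocalProtocol n X M)
    (R' : List Bool → X → ProbabilityMeasure M) {s : List Bool → X → Set M}
    (hs : ∀ a i, MeasurableSet (s a i))
    (hR' : ∀ a i, (P.R a i : Measure M).restrict (s a i) ≤ R' a i) (x : Fin n → X) {E : Set ℝ}
    (hE : MeasurableSet E) :
    P.output x E ≤
      { P with R := R' }.output x E + ∑ i, P.viewProb (x i) fun a => (s a (x i))ᶜ := by
  have := P.markov
  rw [output_apply _ _ hE, output_apply _ _ hE]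
  simp_rw [viewProb]
  rw [← Summable.tsum_finsetSum fun _ _ => ENNReal.summable, ← ENNReal.tsum_add]
  refine ENNReal.tsum_le_tsum fun a => ?_
  rw [← Finset.mul_sum, ← mul_add]
  gcongr
  exact lintegral_pi_le_add_sum (fun i => hs a (x i)) (fun i => hR' a (x i)) fun y => prob_le_one

theorem IsLocallyDP.exists_isDominated {P : PublicCoinLocalProtocol n X M} {ε δ : ℝ}
    (hP : P.IsLocallyDP ε δ) (z : X) :
    ∃ P' : PublicCoinLocalProtocol n X M,
      P'.IsDominated z (2 * (Real.exp ε).toNNReal + 1) ∧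
      ∀ (x : Fin n → X) (E : Set ℝ), MeasurableSet E →
        P.output x E ≤ P'.output x E + ENNReal.ofReal (2 * n * δ) := by
  -- the reference randomizer has to be kept, since the others are compared with it
  have exists_truncation (a i) : ∃ (s : Set M) (Q : ProbabilityMeasure M), MeasurableSet s ∧
      Q ≤ (2 * (Real.exp ε).toNNReal + 1) • (P.R a z : Measure M) ∧
      (P.R a i : Measure M).restrict s ≤ Q ∧
      2 * ENNReal.ofReal (Real.exp ε) * (P.R a z : Measure M) sᶜ ≤ (P.R a i : Measure M) sᶜ ∧
      (i = z → Q = P.R a z) := by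
    obtain rfl | hi := eq_or_ne i z
    · refine ⟨Set.univ, P.R a i, .univ, ?_, by simp, by simp, fun _ => rfl⟩
      rw [add_smul, one_smul]
      exact Measure.le_add_left le_rfl
    · obtain ⟨s, Q, hs, hQ⟩ := exists_dominated_truncation (P.R a z : Measure M)
        (P.R a i : Measure M) (2 * (Real.exp ε).toNNReal)
      rw [ENNReal.coe_mul, ENNReal.coe_ofNat] at hQ
      exact ⟨s, Q, hs, hQ.1, hQ.2.1, hQ.2.2, fun h => absurd h hi⟩
  choose s R' hs dominated restrict_le tail ref_eq using exists_truncation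
  refine ⟨{ P with R := R' }, fun a i => ?_, fun x E hE => ?_⟩
  · simpa only [ref_eq a z rfl] using dominated a i
  refine (P.output_le_output_add_sum_viewProb R' hs restrict_le x hE).trans ?_
  gcongr
  calc
    ∑ i, P.viewProb (x i) (fun a => (s a (x i))ᶜ) ≤ ∑ _i : Fin n, ENNReal.ofReal (2 * δ) := by
      gcongr with i
      exact hP.viewProb_le_of_forall_two_mul_exp_mul_le (fun a => (hs a _).compl) fun a => tail a _
    _ = ENNReal.ofReal (2 * n * δ) := by
      rw [Finset.sum_const, Finset.card_univ, Fintype.card_fin, ← ENNReal.ofReal_nsmul,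
        nsmul_eq_mul]
      ring_nf

end PublicCoinLocalProtocol

section ChooseBounds

theorem pow_le_choose_of_two_mul_le {j K m : ℕ} (hj : j ≤ K) (hKm : 2 * K ≤ m) :
    ((m : ℝ) / (2 * K)) ^ j ≤ m.choose j := by
  obtain rfl | hj0 := j.eq_zero_or_pos
  · simp
  have : 0 < (K : ℝ) := by exact_mod_cast hj0.trans_le hj
  have half_le : (m : ℝ) / 2 ≤ (m + 1 - j : ℕ) := by
    have : m ≤ 2 * (m + 1 - j) := by lia
    rw [div_le_iff₀' zero_lt_two]
    exact_mod_cast this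
  calc
    ((m : ℝ) / (2 * K)) ^ j = ((m : ℝ) / 2) ^ j / (K : ℝ) ^ j := by rw [← div_div, div_pow]
    _ ≤ ((m + 1 - j : ℕ) : ℝ) ^ j / j.factorial := by
      gcongr
      exact_mod_cast j.factorial_le_pow.trans (Nat.pow_le_pow_left hj j)
    _ ≤ m.choose j := Nat.pow_le_choose j m

theorem sqrt_pow_div_choose_le {j K m : ℕ} {C : ℝ} (hj : j ≤ K) (hC : 1 ≤ C) (hK : 1 ≤ K)
    (hm : 32 * C * (K : ℝ) ^ 3 ≤ m) : √(C ^ j / m.choose j) ≤ (1 / (4 * K)) ^ j := by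
  have hK' : (1 : ℝ) ≤ K := by exact_mod_cast hK
  have hm_pos : (0 : ℝ) < m := hm.trans_lt' (by positivity)
  have hKm : 2 * K ≤ m := by
    have : (K : ℝ) ≤ (K : ℝ) ^ 3 := le_self_pow₀ hK' three_ne_zero
    have : ((2 * K : ℕ) : ℝ) ≤ m := by push_cast; nlinarith
    exact_mod_cast this
  rw [Real.sqrt_le_left (by positivity)]
  calc
    C ^ j / m.choose j ≤ C ^ j / ((m : ℝ) / (2 * K)) ^ j := by
      gcongr
      exact pow_le_choose_of_two_mul_le hj hKm
    _ = (2 * C * K / m) ^ j := by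
      rw [← div_pow]
      field_simp
    _ ≤ ((1 / (4 * K)) ^ 2) ^ j := by
      gcongr
      rw [div_le_iff₀ hm_pos]
      field_simp
      linarith
    _ = ((1 / (4 * K)) ^ j) ^ 2 := pow_right_comm _ _ _

theorem abs_sum_mul_choose_le {K : ℕ} (w : Fin (K + 1) → ℝ) (j : ℕ) :
    |∑ k, w k * ((k : ℕ).choose j : ℝ)| ≤ (∑ k, |w k|) * (K : ℝ) ^ j := by
  rw [Finset.sum_mul]
  refine (Finset.abs_sum_le_sum_abs _ _).trans (Finset.sum_le_sum fun k _ => ?_)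
  rw [abs_mul, Nat.abs_cast]
  gcongr
  exact_mod_cast (Nat.choose_le_pow k j).trans (Nat.pow_le_pow_left k.is_le j)

theorem sum_abs_moment_mul_sqrt_le {d K m : ℕ} {C : ℝ} (hC : 1 ≤ C) (hK : 1 ≤ K)
    (hm : 32 * C * (K : ℝ) ^ 3 ≤ m) {w : Fin (K + 1) → ℝ} (hw : ∑ k, |w k| ≤ 2)
    (hw_zero : ∀ j ≤ d, ∑ k, w k * ((k : ℕ).choose j : ℝ) = 0) :
    ∑ j ∈ Finset.range (K + 1), |∑ k, w k * ((k : ℕ).choose j : ℝ)| * √(C ^ j / m.choose j) ≤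
      (1 / 4) ^ d := by
  set b : ℕ → ℝ := fun j => |∑ k, w k * ((k : ℕ).choose j : ℝ)| * √(C ^ j / m.choose j)
  have b_eq_zero {j} (hj : j ≤ d) : b j = 0 := by simp [b, hw_zero j hj]
  have b_le {j} (hj : j ≤ K) : b j ≤ 2 * (1 / 4) ^ j := by
    calc
      b j ≤ (2 * (K : ℝ) ^ j) * (1 / (4 * K)) ^ j := by
        refine mul_le_mul ((abs_sum_mul_choose_le w j).trans ?_)
          (sqrt_pow_div_choose_le hj hC hK hm) (Real.sqrt_nonneg _) (by positivity)
        gcongr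
      _ = 2 * (1 / 4) ^ j := by
        rw [mul_assoc, ← mul_pow]
        field_simp
  calc
    ∑ j ∈ Finset.range (K + 1), b j = ∑ j ∈ Finset.range (K + 1) with d + 1 ≤ j, b j := by
      refine (Finset.sum_filter_of_ne fun j _ hj => ?_).symm
      contrapose! hj
      exact b_eq_zero (by lia)
    _ ≤ ∑ j ∈ Finset.Ico (d + 1) (K + 1), 2 * (1 / 4) ^ j := by
      rw [show (Finset.range (K + 1)).filter (d + 1 ≤ ·) = Finset.Ico (d + 1) (K + 1) by
        ext; simp; lia]
      exact Finset.sum_le_sum fun j hj => b_le (by simp at hj; lia)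
    _ ≤ 2 * ((1 / 4) ^ (d + 1) / (1 - 1 / 4)) := by
      rw [← Finset.mul_sum]
      gcongr
      exact geom_sum_Ico_le_of_lt_one (by norm_num) (by norm_num)
    _ = 2 / 3 * (1 / 4) ^ d := by ring
    _ ≤ (1 / 4) ^ d := mul_le_of_le_one_left (by positivity) (by norm_num)

end ChooseBounds

section BlockDataset

variable {ι : Type*} {D K : ℕ}

/-- The dataset that holds `N i` copies of the element `i + 1`, for every `i`, and otherwise copies
of the element `0`. The embedding `e` assigns to every nonzero element a block of `K` positions; the
copies of `i + 1` occupy the first `N i` positions of its block. -/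
noncomputable def blockDataset (e : Fin D × Fin K ↪ ι) (N : Fin D → Fin (K + 1)) :
    ι → Fin (D + 1) :=
  Function.extend e (fun p => if (p.2 : ℕ) < N p.1 then p.1.succ else 0) 0

/-- The first `k` positions of the `i`-th block. -/
def blockPositions (e : Fin D × Fin K ↪ ι) (i : Fin D) (k : ℕ) : Finset ι :=
  (Finset.univ.filter fun r : Fin K => (r : ℕ) < k).map ((Function.Embedding.sectR i _).trans e)

variable (e : Fin D × Fin K ↪ ι) (N : Fin D → Fin (K + 1))

theorem blockDataset_apply (p : Fin D × Fin K) :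
    blockDataset e N (e p) = if (p.2 : ℕ) < N p.1 then p.1.succ else 0 :=
  e.injective.extend_apply _ _ p

theorem blockDataset_of_notMem_range {j : ι} (hj : j ∉ Set.range e) : blockDataset e N j = 0 :=
  Function.extend_apply' _ _ _ hj

theorem card_blockPositions (i : Fin D) (k : Fin (K + 1)) : (blockPositions e i k).card = k := by
  rw [blockPositions, Finset.card_map, Fin.card_filter_val_lt, min_eq_right k.is_le]

theorem blockDataset_update [DecidableEq ι] (i : Fin D) (a : Fin (K + 1)) :
    blockDataset e (Function.update N i a) = (blockPositions e i a).piecewise (fun _ => i.succ)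
      (blockDataset e (Function.update N i 0)) := by
  funext j
  by_cases hj : j ∈ Set.range e
  · obtain ⟨⟨i', r⟩, rfl⟩ := hj
    obtain rfl | hi := eq_or_ne i' i
    · simp [Finset.piecewise, blockPositions, blockDataset_apply]
    · simp [Finset.piecewise, blockPositions, blockDataset_apply, hi, hi.symm]
  · have : j ∉ blockPositions e i a := fun h => by
      obtain ⟨r, -, rfl⟩ := Finset.mem_map.1 h
      exact hj ⟨_, rfl⟩
    simp [this, blockDataset_of_notMem_range e _ hj]

theorem blockDataset_update_zero_eq_zero {i : Fin D} {k : ℕ} {j : ι}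
    (hj : j ∈ blockPositions e i k) : blockDataset e (Function.update N i 0) j = 0 := by
  obtain ⟨r, -, rfl⟩ := Finset.mem_map.1 hj
  simp [blockDataset_apply]

theorem card_le_card_blockDataset_eq_zero_add [Fintype ι] :
    Fintype.card ι ≤ (Finset.univ.filter fun j => blockDataset e N j = 0).card + D * K := by
  classical
  have nonzero_subset :
      (Finset.univ.filter fun j => ¬ blockDataset e N j = 0) ⊆ Finset.univ.map e := by
    intro j hj
    by_contra h
    exact (Finset.mem_filter.1 hj).2 (blockDataset_of_notMem_range e N (by simpa using h))
  have := Finset.card_le_card nonzero_subset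
  rw [← Finset.card_univ, ← Finset.card_filter_add_card_filter_not fun j => blockDataset e N j = 0]
  simpa using this

theorem ncard_range_blockDataset_le :
    (Set.range (blockDataset e N)).ncard ≤ (Finset.univ.filter fun i => N i ≠ 0).card + 1 := by
  classical
  have range_subset : Set.range (blockDataset e N) ⊆
      (insert 0 ((Finset.univ.filter fun i => N i ≠ 0).map (Fin.succEmb D)) : Finset _) := by
    rintro _ ⟨j, rfl⟩
    by_cases hj : j ∈ Set.range e
    · obtain ⟨p, rfl⟩ := hj
      rw [blockDataset_apply]
      split_ifs with hp
      · have : N p.1 ≠ 0 := fun h => by simp [h] at hp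
        simp [this]
      · simp
    · simp [blockDataset_of_notMem_range e N hj]
  calc
    _ ≤ _ := Set.ncard_le_ncard range_subset
    _ ≤ _ := by
      rw [Set.ncard_coe_finset]
      exact (Finset.card_insert_le _ _).trans_eq (by rw [Finset.card_map])

theorem blockDataset_surjective [Fintype ι] (hDK : D * K < Fintype.card ι) (hN : ∀ i, N i ≠ 0) :
    Function.Surjective (blockDataset e N) := by
  refine Fin.cases ?_ fun i => ?_
  · have : 0 < (Finset.univ.filter fun j => blockDataset e N j = 0).card := by
      have := card_le_card_blockDataset_eq_zero_add e N
      lia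
    obtain ⟨j, hj⟩ := Finset.card_pos.1 this
    exact ⟨j, (Finset.mem_filter.1 hj).2⟩
  · have pos : 0 < (N i : ℕ) := Fin.pos_iff_ne_zero.2 (hN i)
    exact ⟨e (i, ⟨0, pos.trans_le (N i).is_le⟩), by simp [blockDataset_apply, pos]⟩

end BlockDataset

theorem integral_pi_comp_perm {ι M : Type*} [Fintype ι] [MeasurableSpace M] (ρ : ι → Measure M)
    [∀ i, SigmaFinite (ρ i)] (σ : Equiv.Perm ι) (φ : (ι → M) → ℝ) :
    ∫ y, φ y ∂Measure.pi (ρ ∘ σ) = ∫ y, φ (y ∘ σ) ∂Measure.pi ρ := by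
  rw [← (measurePreserving_piCongrLeft ρ σ).integral_comp']
  refine integral_congr_ae (.of_forall fun y => congrArg φ (funext fun i => ?_))
  exact (MeasurableEquiv.piCongrLeft_apply_apply (β := fun _ => M) (e := σ) y i).symm

section SymmetrizedDataset

variable {ι M : Type*} [Fintype ι] [DecidableEq ι] [MeasurableSpace M]

theorem expect_perm_integral_pi_piecewise {X : Type*} {R : X → Measure M}
    [∀ i, IsProbabilityMeasure (R i)] (φ : (ι → M) → ℝ) {x : ι → X} {a c : X} {F T : Finset ι}
    (hF : ∀ j ∈ F, x j = a) (hT : T ⊆ F) :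
    𝔼 σ : Equiv.Perm ι, ∫ y, φ y ∂Measure.pi (R ∘ T.piecewise (fun _ => c) x ∘ σ) =
      𝔼 σ : Equiv.Perm ι, 𝔼 S ∈ F.powersetCard T.card,
        ∫ y, φ (y ∘ σ) ∂Measure.pi (S.piecewise (fun _ => R c) (R ∘ x)) := by
  rw [expect_perm_piecewise (fun x => ∫ y, φ y ∂Measure.pi (R ∘ x)) hF hT]
  refine Finset.expect_congr rfl fun σ _ => Finset.expect_congr rfl fun S _ => ?_
  have sigmaFinite (j) : SigmaFinite ((R ∘ S.piecewise (fun _ => c) x) j) :=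
    inferInstanceAs (SigmaFinite (R _))
  rw [← Function.comp_assoc, integral_pi_comp_perm]
  congr 2
  funext j
  simp only [Function.comp_apply, Finset.piecewise, apply_ite R]

theorem abs_sum_mul_expect_perm_blockDataset_le {D K d : ℕ} {R : Fin (D + 1) → Measure M}
    [∀ i, IsProbabilityMeasure (R i)] {C : ℝ≥0} (hC : 1 ≤ C) (hR : ∀ i, R i ≤ C • R 0)
    {φ : (ι → M) → ℝ} (hφ : Measurable φ) (hφ_le : ∀ y, |φ y| ≤ 1) (hK : 1 ≤ K)
    (hDK : 2 * (D * K) ≤ Fintype.card ι) (hCK : 64 * C * (K : ℝ) ^ 3 ≤ Fintype.card ι)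
    {w : Fin (K + 1) → ℝ} (hw : ∑ k, |w k| ≤ 2)
    (hw_zero : ∀ j ≤ d, ∑ k, w k * ((k : ℕ).choose j : ℝ) = 0) (e : Fin D × Fin K ↪ ι) (i : Fin D)
    (N : Fin D → Fin (K + 1)) :
    |∑ a, w a * 𝔼 σ : Equiv.Perm ι,
        ∫ y, φ y ∂Measure.pi (R ∘ blockDataset e (Function.update N i a) ∘ σ)| ≤ (1 / 4) ^ d := by
  set x := blockDataset e (Function.update N i 0) with hx
  set F := Finset.univ.filter fun j => x j = 0 with hF
  have eq_zero : ∀ j ∈ F, x j = 0 := by simp [hF]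
  have card_le : Fintype.card ι ≤ 2 * F.card := by
    have := card_le_card_blockDataset_eq_zero_add e (Function.update N i 0)
    lia
  have card_F : 32 * C * (K : ℝ) ^ 3 ≤ F.card := by
    have : (Fintype.card ι : ℝ) ≤ 2 * F.card := by exact_mod_cast card_le
    linarith
  have K_le : K ≤ F.card := by
    have : 0 < D := i.pos
    nlinarith
  obtain ⟨f, hf, hfC, hRf⟩ := exists_density_of_le_smul (hR i.succ)
  have : IsProbabilityMeasure ((R 0).withDensity fun m => f m) := hRf ▸ inferInstance
  have isProbabilityMeasure (j) : IsProbabilityMeasure ((R ∘ x) j) :=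
    inferInstanceAs (IsProbabilityMeasure (R _))
  have symmetrize (a : Fin (K + 1)) := by
    have subset_F : blockPositions e i a ⊆ F := fun j hj => by
      simp [hF, hx, blockDataset_update_zero_eq_zero e N hj]
    have := expect_perm_integral_pi_piecewise (R := R) φ (c := i.succ) eq_zero subset_F
    rwa [card_blockPositions, ← blockDataset_update, hRf] at this
  have expect_comm : ∑ a, w a * 𝔼 σ : Equiv.Perm ι,
        ∫ y, φ y ∂Measure.pi (R ∘ blockDataset e (Function.update N i a) ∘ σ) =
      𝔼 σ : Equiv.Perm ι, ∑ a, w a * 𝔼 S ∈ F.powersetCard a, ∫ y, φ (y ∘ σ) ∂Measure.pi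
        (S.piecewise (fun _ => (R 0).withDensity fun m => f m) (R ∘ x)) := by
    rw [Finset.expect_sum_comm]
    exact Finset.sum_congr rfl fun a _ => by rw [symmetrize, Finset.mul_expect]
  rw [expect_comm]
  refine (Finset.abs_expect_le _ _).trans (Finset.expect_le Finset.univ_nonempty fun σ _ => ?_)
  exact (abs_sum_mul_expect_integral_le hf hfC (fun j hj => by simp [eq_zero j hj]) (by fun_prop)
    (fun y => hφ_le _) (by lia) w).trans (sum_abs_moment_mul_sqrt_le hC hK card_F hw hw_zero)

end SymmetrizedDataset

namespace PublicCoinLocalProtocol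

variable {n : ℕ} {X : Type} {M : Type u} [MeasurableSpace M] (P : PublicCoinLocalProtocol n X M)

instance isProbabilityMeasure_output (x : Fin n → X) : IsProbabilityMeasure (P.output x) := by
  have := P.markov
  exact ⟨by simp [output_apply _ _ MeasurableSet.univ, P.pub.tsum_coe]⟩

theorem hasSum_pub_toReal : HasSum (fun a => (P.pub a).toReal) 1 := by
  have := ENNReal.hasSum_toReal P.pub.tsum_coe_ne_top
  rwa [← ENNReal.tsum_toReal_eq P.pub.apply_ne_top, P.pub.tsum_coe, ENNReal.toReal_one] at this

theorem hasSum_output_real (x : Fin n → X) {E : Set ℝ} (hE : MeasurableSet E) :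
    HasSum (fun a => (P.pub a).toReal *
      ∫ y, (P.A a y).real E ∂Measure.pi fun i => (P.R a (x i) : Measure M))
      ((P.output x).real E) := by
  have := P.markov
  have ne_top : P.output x E ≠ ∞ := measure_ne_top _ _
  rw [measureReal_def]
  rw [output_apply _ _ hE] at ne_top ⊢
  rw [ENNReal.tsum_toReal_eq (ENNReal.ne_top_of_tsum_ne_top ne_top)]
  convert ENNReal.hasSum_toReal ne_top using 2 with a
  rw [ENNReal.toReal_mul, ← integral_toReal ((P.A a).measurable_coe hE).aemeasurable
    (.of_forall fun y => measure_lt_top _ _)]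
  rfl

theorem abs_sum_mul_expect_output_real_le {κ τ : Type*} [Fintype κ] [Fintype τ] (c : κ → ℝ)
    (x : κ → τ → Fin n → X) {E : Set ℝ} (hE : MeasurableSet E) {η : ℝ}
    (h : ∀ a, |∑ k, c k * 𝔼 t,
      ∫ y, (P.A a y).real E ∂Measure.pi fun i => (P.R a (x k t i) : Measure M)| ≤ η) :
    |∑ k, c k * 𝔼 t, (P.output (x k t)).real E| ≤ η := by
  have hasSum_expect (k : κ) : HasSum (fun a => (P.pub a).toReal * 𝔼 t,
      ∫ y, (P.A a y).real E ∂Measure.pi fun i => (P.R a (x k t i) : Measure M))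
      (𝔼 t, (P.output (x k t)).real E) := by
    simp_rw [Finset.mul_expect, Finset.expect_eq_sum_div_card]
    exact (hasSum_sum fun t _ => P.hasSum_output_real (x k t) hE).div_const _
  have hasSum : HasSum (fun a => (P.pub a).toReal * ∑ k, c k * 𝔼 t,
      ∫ y, (P.A a y).real E ∂Measure.pi fun i => (P.R a (x k t i) : Measure M))
      (∑ k, c k * 𝔼 t, (P.output (x k t)).real E) := by
    simp_rw [Finset.mul_sum, mul_left_comm _ (c _)]
    exact hasSum_sum fun k _ => (hasSum_expect k).mul_left _
  have hasSum_bound : HasSum (fun a => (P.pub a).toReal * η) η := by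
    simpa using P.hasSum_pub_toReal.mul_right η
  refine abs_le.2 ⟨hasSum_le (fun a => ?_) hasSum_bound.neg hasSum,
    hasSum_le (fun a => ?_) hasSum hasSum_bound⟩
  · rw [← mul_neg]
    exact mul_le_mul_of_nonneg_left (neg_le_of_abs_le (h a)) ENNReal.toReal_nonneg
  · exact mul_le_mul_of_nonneg_left (le_of_abs_le (h a)) ENNReal.toReal_nonneg

variable {P}

theorem countDistinct_comp_perm (x : Fin n → X) (σ : Equiv.Perm (Fin n)) :
    countDistinct (x ∘ σ) = countDistinct x := by
  rw [countDistinct, countDistinct, σ.surjective.range_comp]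

theorem SolvesCountDistinct.le_expect_perm_output_real {t : ℝ} (hP : P.SolvesCountDistinct t)
    {P' : PublicCoinLocalProtocol n X M} {η : ℝ} (hη : 0 ≤ η) {E : Set ℝ}
    (h : ∀ x, P.output x E ≤ P'.output x E + ENNReal.ofReal η) {x : Fin n → X}
    (hE : ∀ s : ℝ, |s - (countDistinct x : ℝ)| ≤ t → s ∈ E) :
    0.99 - η ≤ 𝔼 σ : Equiv.Perm (Fin n), (P'.output (x ∘ σ)).real E := by
  refine Finset.le_expect Finset.univ_nonempty fun σ _ => ?_
  rw [← countDistinct_comp_perm x σ] at hE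
  have : ENNReal.ofReal 0.99 ≤ ENNReal.ofReal ((P'.output (x ∘ σ)).real E + η) := by
    rw [ENNReal.ofReal_add measureReal_nonneg hη, ofReal_measureReal]
    exact (hP (x ∘ σ)).trans ((measure_mono hE).trans (h _))
  rw [ENNReal.ofReal_le_ofReal_iff (by positivity)] at this
  linarith

theorem SolvesCountDistinct.expect_perm_output_real_le {t : ℝ} (hP : P.SolvesCountDistinct t)
    {P' : PublicCoinLocalProtocol n X M} {η : ℝ} (hη : 0 ≤ η) {E : Set ℝ} (hE : MeasurableSet E)
    (h : ∀ x, P.output x Eᶜ ≤ P'.output x Eᶜ + ENNReal.ofReal η) {x : Fin n → X}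
    (hxE : ∀ s : ℝ, |s - (countDistinct x : ℝ)| ≤ t → s ∉ E) :
    𝔼 σ : Equiv.Perm (Fin n), (P'.output (x ∘ σ)).real E ≤ 0.01 + η := by
  have := hP.le_expect_perm_output_real hη h hxE
  simp_rw [probReal_compl_eq_one_sub hE] at this
  rw [Finset.expect_sub_distrib, Finset.expect_const Finset.univ_nonempty] at this
  linarith

end PublicCoinLocalProtocol

section RandomCounts

theorem sum_prod_mul_comp_eval {ι α : Type*} [Fintype ι] [DecidableEq ι] [Fintype α] {w : α → ℝ}
    (hw : w ∈ stdSimplex ℝ α) (i : ι) (f : α → ℝ) :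
    ∑ N : ι → α, (∏ j, w (N j)) * f (N i) = ∑ a, w a * f a := by
  have prod_mul (N : ι → α) :
      (∏ j, w (N j)) * f (N i) = ∏ j, w (N j) * if j = i then f (N j) else 1 := by
    rw [Finset.prod_mul_distrib, Finset.prod_ite_eq' Finset.univ i, if_pos (Finset.mem_univ i)]
  simp_rw [prod_mul, ← Fintype.prod_sum fun j a => w a * if j = i then f a else 1]
  rw [Finset.prod_eq_single i _ (by simp)]
  · simp only [if_true]
  · intro j _ hj
    simp [hj, hw.2]

theorem mul_one_sub_div_le_sum_mul {Ω : Type*} [Fintype Ω] {p X ψ : Ω → ℝ} {c t : ℝ}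
    (hp : p ∈ stdSimplex ℝ Ω) (hX : ∀ ω, 0 ≤ X ω) (hψ : ∀ ω, 0 ≤ ψ ω) (hc : 0 ≤ c) (ht : 0 < t)
    (hXψ : ∀ ω, X ω ≤ t → c ≤ ψ ω) :
    c * (1 - (∑ ω, p ω * X ω) / t) ≤ ∑ ω, p ω * ψ ω := by
  have pointwise (ω : Ω) : c * (1 - X ω / t) ≤ ψ ω := by
    obtain h | h := le_or_gt (X ω) t
    · exact (mul_le_of_le_one_right hc (sub_le_self _ (div_nonneg (hX ω) ht.le))).trans (hXψ ω h)
    · exact (mul_nonpos_of_nonneg_of_nonpos hc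
        (sub_nonpos.2 ((one_le_div ht).2 h.le))).trans (hψ ω)
  calc
    c * (1 - (∑ ω, p ω * X ω) / t) = ∑ ω, p ω * (c * (1 - X ω / t)) := by
      conv_lhs => rw [← hp.2, Finset.sum_div, ← Finset.sum_sub_distrib, Finset.mul_sum]
      exact Finset.sum_congr rfl fun ω _ => by ring
    _ ≤ ∑ ω, p ω * ψ ω := Finset.sum_le_sum fun ω _ =>
      mul_le_mul_of_nonneg_left (pointwise ω) (hp.1 ω)

variable {D K : ℕ} {ψ : (Fin D → Fin (K + 1)) → ℝ} {c : ℝ}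

theorem div_three_le_sum_prod_mul {u : Fin (K + 1) → ℝ} (hu : u ∈ stdSimplex ℝ (Fin (K + 1)))
    (hu0 : 1 / 2 ≤ u 0) (hD : 1 ≤ D) (hc : 0 ≤ c) (hψ_nonneg : ∀ N, 0 ≤ ψ N)
    (hψ : ∀ N, ((Finset.univ.filter fun i => N i ≠ 0).card : ℝ) ≤ 3 / 4 * D → c ≤ ψ N) :
    c / 3 ≤ ∑ N, (∏ i, u (N i)) * ψ N := by
  have : (0 : ℝ) < D := by exact_mod_cast hD
  have marginal : ∑ a, u a * (if a ≠ 0 then 1 else 0) ≤ 1 / 2 := by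
    have := hu.2
    rw [Fin.sum_univ_succ] at this ⊢
    simp only [ne_eq, Fin.succ_ne_zero, not_true_eq_false, not_false_eq_true, if_true, if_false,
      mul_zero, mul_one, zero_add]
    linarith
  have expectation_le : ∑ N : Fin D → Fin (K + 1), (∏ i, u (N i)) *
      ((Finset.univ.filter fun i => N i ≠ 0).card : ℝ) ≤ D / 2 := by
    simp_rw [← Finset.sum_boole, Finset.mul_sum]
    rw [Finset.sum_comm]
    simp_rw [fun i => sum_prod_mul_comp_eval hu i fun a => if a ≠ 0 then 1 else 0]
    rw [Finset.sum_const, Finset.card_univ, Fintype.card_fin, nsmul_eq_mul]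
    nlinarith
  calc
    c / 3 = c * (1 - D / 2 / (3 / 4 * D)) := by field_simp; norm_num
    _ ≤ c * (1 - (∑ N : Fin D → Fin (K + 1), (∏ i, u (N i)) *
        ((Finset.univ.filter fun i => N i ≠ 0).card : ℝ)) / (3 / 4 * D)) := by gcongr
    _ ≤ ∑ N, (∏ i, u (N i)) * ψ N := mul_one_sub_div_le_sum_mul (prod_mem_stdSimplex hu)
      (fun N => Nat.cast_nonneg _) hψ_nonneg hc (by positivity) hψ

theorem sum_prod_mul_le_of_forall_ne_zero {v : Fin (K + 1) → ℝ}
    (hv : v ∈ stdSimplex ℝ (Fin (K + 1))) (hv0 : v 0 = 0)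
    (hψ : ∀ N, (∀ i, N i ≠ 0) → ψ N ≤ c) : ∑ N, (∏ i, v (N i)) * ψ N ≤ c := by
  have hprod := prod_mem_stdSimplex (ι := Fin D) hv
  calc
    ∑ N, (∏ i, v (N i)) * ψ N ≤ ∑ N : Fin D → Fin (K + 1), (∏ i, v (N i)) * c := by
      refine Finset.sum_le_sum fun N _ => ?_
      by_cases hN : ∀ i, N i ≠ 0
      · exact mul_le_mul_of_nonneg_left (hψ N hN) (hprod.1 N)
      · obtain ⟨i, hi⟩ := not_forall_not.1 hN
        have : ∏ i, v (N i) = 0 := Finset.prod_eq_zero (Finset.mem_univ i) (by rw [hi, hv0])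
        simp [this]
    _ = c := by rw [← Finset.sum_mul, hprod.2, one_mul]

end RandomCounts

namespace PublicCoinLocalProtocol

variable {n D d : ℕ} {M : Type u} [MeasurableSpace M]

theorem IsDominated.abs_sum_mul_expect_perm_output_le {K : ℕ}
    {P : PublicCoinLocalProtocol n (Fin (D + 1)) M} {C : ℝ≥0} (hP : P.IsDominated 0 C)
    (hC : 1 ≤ C) (hK : 1 ≤ K) (hDK : 2 * (D * K) ≤ n) (hCK : 64 * C * (K : ℝ) ^ 3 ≤ n)
    {w : Fin (K + 1) → ℝ} (hw : ∑ k, |w k| ≤ 2)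
    (hw_zero : ∀ j ≤ d, ∑ k, w k * ((k : ℕ).choose j : ℝ) = 0) (e : Fin D × Fin K ↪ Fin n)
    {E : Set ℝ} (hE : MeasurableSet E) (i : Fin D) (N : Fin D → Fin (K + 1)) :
    |∑ a, w a * 𝔼 σ : Equiv.Perm (Fin n),
        (P.output (blockDataset e (Function.update N i a) ∘ σ)).real E| ≤ (1 / 4) ^ d := by
  have := P.markov
  rw [← Fintype.card_fin n] at hDK hCK
  refine P.abs_sum_mul_expect_output_real_le w _ hE fun a => ?_
  refine abs_sum_mul_expect_perm_blockDataset_le (R := fun i => (P.R a i : Measure M)) hC (hP a)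
    ((P.A a).measurable_coe hE).ennreal_toReal (fun y => ?_) hK hDK hCK hw hw_zero e i N
  rw [abs_of_nonneg ENNReal.toReal_nonneg]
  exact measureReal_le_one

theorem IsLocallyDP.not_solvesCountDistinct {P : PublicCoinLocalProtocol n (Fin (D + 1)) M}
    {ε δ t : ℝ} (hP : P.IsLocallyDP ε δ) (hD : 1 ≤ D) (hn : 2 * (D * (4 * d ^ 2 + 1)) ≤ n)
    (hε : 64 * (2 * Real.exp ε + 1) * (4 * d ^ 2 + 1) ^ 3 ≤ n)
    (hd : D * (1 / 4 : ℝ) ^ d ≤ 1 / 20) (hδ : n * δ ≤ 1 / 40) (ht : t + 1 ≤ D / 8) :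
    ¬ P.SolvesCountDistinct t := by
  intro hS
  obtain ⟨P', hP', output_le⟩ := hP.exists_isDominated 0
  replace output_le (x) {A : Set ℝ} (hA : MeasurableSet A) :
      P.output x A ≤ P'.output x A + ENNReal.ofReal (1 / 20) :=
    (output_le x A hA).trans (by gcongr; linarith)
  obtain ⟨u, hu, v, hv, hu0, hv0, moments⟩ := exists_stdSimplex_matching_moments d
  have ⟨e⟩ : Nonempty (Fin D × Fin (4 * d ^ 2 + 1) ↪ Fin n) :=
    Function.Embedding.nonempty_of_card_le (by simp; lia)
  set E : Set ℝ := {s | s ≤ 7 / 8 * D + 1 / 2}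
  have hE : MeasurableSet E := measurableSet_Iic
  set ψ : (Fin D → Fin (4 * d ^ 2 + 1 + 1)) → ℝ := fun N =>
    𝔼 σ : Equiv.Perm (Fin n), (P'.output (blockDataset e N ∘ σ)).real E
  have ψ_ge (N) (hN : ((Finset.univ.filter fun i => N i ≠ 0).card : ℝ) ≤ 3 / 4 * D) :
      0.99 - 1 / 20 ≤ ψ N := by
    refine hS.le_expect_perm_output_real (by norm_num) (fun x => output_le x hE) fun s hs => ?_
    have count_le : (countDistinct (blockDataset e N) : ℝ) ≤ _ :=
      Nat.cast_le.2 (ncard_range_blockDataset_le e N)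
    push_cast at count_le
    exact (by linarith [(abs_le.1 hs).2] : s ≤ 7 / 8 * D + 1 / 2)
  have ψ_le (N) (hN : ∀ i, N i ≠ 0) : ψ N ≤ 0.01 + 1 / 20 := by
    refine hS.expect_perm_output_real_le (by norm_num) hE (fun x => output_le x hE.compl)
      fun s hs (hsE : s ≤ 7 / 8 * D + 1 / 2) => ?_
    have count_eq : countDistinct (blockDataset e N) = D + 1 := by
      simp [countDistinct, (blockDataset_surjective e N (by simp; lia) hN).range_eq]
    rw [count_eq, Nat.cast_add_one] at hs
    linarith [(abs_le.1 hs).1]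
  have lower := div_three_le_sum_prod_mul hu hu0 hD (by norm_num)
    (fun N => Finset.expect_nonneg fun σ _ => measureReal_nonneg) ψ_ge
  have upper := sum_prod_mul_le_of_forall_ne_zero hv hv0 ψ_le
  have close := abs_sum_prod_sub_prod_mul_le hu hv ψ fun i N =>
    hP'.abs_sum_mul_expect_perm_output_le le_add_self (by lia) hn
      (by simpa [Real.exp_nonneg] using hε) (sum_abs_sub_le_two_of_mem_stdSimplex hu hv) moments e
      hE i N
  simp_rw [sub_mul, Finset.sum_sub_distrib] at close
  linarith [(abs_le.1 close).2]

end PublicCoinLocalProtocol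

theorem eventually_mul_log_pow_le (c : ℝ) (k : ℕ) :
    ∀ᶠ n : ℕ in atTop, c * Real.log n ^ k ≤ n := by
  have log_pow_isLittleO : (fun n : ℕ => c * Real.log n ^ k) =o[atTop] fun n : ℕ => (n : ℝ) :=
    ((Real.isLittleO_pow_log_id_atTop (n := k)).comp_tendsto
      tendsto_natCast_atTop_atTop).const_mul_left c
  filter_upwards [log_pow_isLittleO.bound one_pos] with n hn
  rw [one_mul, Real.norm_of_nonneg n.cast_nonneg] at hn
  exact (le_abs_self _).trans hn

theorem eventually_le_log_natCast (c : ℝ) : ∀ᶠ n : ℕ in atTop, c ≤ Real.log n :=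
  (Real.tendsto_log_atTop.comp tendsto_natCast_atTop_atTop).eventually_ge_atTop c

theorem IsSuperpolynomiallySmall.eventually_natCast_mul_le {δ : ℕ → ℝ}
    (hδ : IsSuperpolynomiallySmall δ) {c : ℝ} (hc : 0 < c) : ∀ᶠ n : ℕ in atTop, n * δ n ≤ c := by
  obtain ⟨g, hg, hδg⟩ := hδ
  filter_upwards [hδg, hg.eventually_ge_atTop 2, eventually_ge_atTop 1,
    (tendsto_inv_atTop_nhds_zero_nat (𝕜 := ℝ)).eventually_le_const hc] with n hδn hgn hn hnc
  have one_le : (1 : ℝ) ≤ n := by exact_mod_cast hn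
  calc n * δ n ≤ n * (n : ℝ) ^ (-2 : ℝ) := by
        gcongr
        exact hδn.trans (Real.rpow_le_rpow_of_exponent_le one_le (by linarith))
    _ = (n : ℝ)⁻¹ := by
        rw [Real.rpow_neg (by linarith), Real.rpow_two]
        field_simp
    _ ≤ c := hnc

theorem exp_log_sub_mul_log_log {x : ℝ} (hx : 0 < x) (hlog : 0 < Real.log x) (k : ℕ) :
    Real.exp (Real.log x - k * Real.log (Real.log x)) = x / Real.log x ^ k := by
  rw [Real.exp_sub, Real.exp_log hx, ← Real.log_pow, Real.exp_log (by positivity)]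

theorem isTheta_floor_div_log_pow (k : ℕ) :
    (fun n : ℕ => (⌊(n : ℝ) / Real.log n ^ k⌋₊ : ℝ)) =Θ[atTop]
      fun n : ℕ => (n : ℝ) / Real.log n ^ k := by
  have two_le : ∀ᶠ n : ℕ in atTop, 2 ≤ (n : ℝ) / Real.log n ^ k := by
    filter_upwards [eventually_le_log_natCast 1, eventually_mul_log_pow_le 2 k] with n hlog hn
    rwa [le_div_iff₀ (by positivity)]
  constructor
  · refine IsBigO.of_bound 1 ?_
    filter_upwards [two_le] with n hn
    rw [Real.norm_of_nonneg (by positivity), Real.norm_of_nonneg (by linarith), one_mul]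
    exact Nat.floor_le (by linarith)
  · refine IsBigO.of_bound 2 ?_
    filter_upwards [two_le] with n hn
    rw [Real.norm_of_nonneg (by linarith), Real.norm_of_nonneg (by positivity)]
    linarith [Nat.lt_floor_add_one ((n : ℝ) / Real.log n ^ k)]

theorem mul_one_div_four_pow_le_div {x : ℝ} {d : ℕ} (hx : 0 < x) (hd : Real.log x ≤ d) {y : ℝ}
    (hy : 0 ≤ y) : y * (1 / 4) ^ d ≤ y / x := by
  have le_four_pow : x ≤ 4 ^ d := by
    calc x = Real.exp (Real.log x) := (Real.exp_log hx).symm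
      _ ≤ Real.exp d := Real.exp_le_exp.2 hd
      _ = Real.exp 1 ^ d := by rw [← Real.exp_nat_mul, mul_one]
      _ ≤ 4 ^ d := by
          gcongr
          linarith [Real.exp_one_lt_d9]
  rw [one_div_pow, mul_one_div]
  gcongr

theorem four_mul_ceil_sq_add_one_le {L : ℝ} (hL : 1 ≤ L) :
    4 * (⌈L⌉₊ : ℝ) ^ 2 + 1 ≤ 20 * L ^ 2 := by
  have ceil_le : (⌈L⌉₊ : ℝ) ≤ 2 * L := by linarith [Nat.ceil_lt_add_one (by linarith : 0 ≤ L)]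
  nlinarith

theorem PublicCoinLocalProtocol.IsLocallyDP.not_solvesCountDistinct_of_le_div_log_pow {n D : ℕ}
    {M : Type u} [MeasurableSpace M] {P : PublicCoinLocalProtocol n (Fin D) M} {δ t : ℝ}
    (hP : P.IsLocallyDP (Real.log n - 7 * Real.log (Real.log n)) δ)
    (hlog : 2048000 ≤ Real.log n) (hn : 1024000 * Real.log n ^ 6 ≤ n) (hD : 100 ≤ D)
    (hDn : (D : ℝ) ≤ n / Real.log n ^ 3) (hδ : n * δ ≤ 1 / 40) (ht : t ≤ D / 16) :
    ¬ P.SolvesCountDistinct t := by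
  obtain ⟨D, rfl⟩ : ∃ D', D = D' + 1 := ⟨D - 1, by lia⟩
  have D_ge : (99 : ℝ) ≤ D := by exact_mod_cast (by lia : 99 ≤ D)
  push_cast at hDn ht
  have n_pos : (0 : ℝ) < n := lt_of_lt_of_le (by positivity) hn
  have exp_eq := exp_log_sub_mul_log_log n_pos (by linarith) 7
  have hd := Nat.le_ceil (Real.log n)
  have K_le := four_mul_ceil_sq_add_one_le (by linarith : 1 ≤ Real.log n)
  have mul_pow_le := fun y hy => mul_one_div_four_pow_le_div (y := y) n_pos hd hy
  set L := Real.log n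
  refine hP.not_solvesCountDistinct (d := ⌈L⌉₊) (by lia) ?_ ?_ ?_ hδ (by linarith)
  · rw [← Nat.cast_le (α := ℝ)]
    push_cast
    calc 2 * (D * (4 * (⌈L⌉₊ : ℝ) ^ 2 + 1)) ≤ 2 * (n / L ^ 3 * (20 * L ^ 2)) := by
          gcongr
          linarith
      _ = 40 * n / L := by field_simp; norm_num
      _ ≤ n := by rw [div_le_iff₀ (by linarith)]; nlinarith
  · rw [show (7 : ℝ) = (7 : ℕ) by norm_num, exp_eq]
    calc 64 * (2 * (n / L ^ 7) + 1) * (4 * (⌈L⌉₊ : ℝ) ^ 2 + 1) ^ 3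
        ≤ 64 * (2 * (n / L ^ 7) + 1) * (20 * L ^ 2) ^ 3 := by gcongr
      _ = 1024000 * n / L + 512000 * L ^ 6 := by field_simp; ring
      _ ≤ n / 2 + n / 2 := by
          refine add_le_add ?_ (by linarith)
          rw [div_le_iff₀ (by linarith)]
          nlinarith
      _ = n := add_halves _
  · calc D * (1 / 4 : ℝ) ^ ⌈L⌉₊ ≤ D / n := mul_pow_le D D.cast_nonneg
      _ ≤ 1 / L ^ 3 := by
          rw [div_le_iff₀ n_pos, one_div_mul_eq_div]
          linarith
      _ ≤ 1 / 20 := by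
          gcongr
          linarith [le_self_pow₀ (by linarith : 1 ≤ L) three_ne_zero]

theorem theorem2_general :
    ∃ (ε : ℕ → ℝ) (D : ℕ → ℕ) (k : ℕ),
      (∀ᶠ n : ℕ in atTop, ε n ≤ Real.log n) ∧
      ((fun n : ℕ => Real.log n - ε n) =O[atTop] fun n : ℕ => Real.log (Real.log n)) ∧
      ((fun n : ℕ => (D n : ℝ)) =Θ[atTop] fun n : ℕ => (n : ℝ) / Real.log n ^ k) ∧
      ∀ᶠ n : ℕ in atTop, ∀ δ e : ℝ, n * δ ≤ 1 / 40 → e ≤ D n / 16 →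
        ∀ (M : Type u) [MeasurableSpace M] (P : PublicCoinLocalProtocol n (Fin (D n)) M),
          P.IsLocallyDP (ε n) δ → ¬ P.SolvesCountDistinct e := by
  refine ⟨fun n => Real.log n - 7 * Real.log (Real.log n), fun n => ⌊(n : ℝ) / Real.log n ^ 3⌋₊, 3,
    ?_, ?_, isTheta_floor_div_log_pow 3, ?_⟩
  · filter_upwards [eventually_le_log_natCast 1] with n hn
    linarith [Real.log_nonneg hn]
  · simp only [sub_sub_cancel]
    exact (isBigO_refl _ _).const_mul_left 7
  · filter_upwards [eventually_le_log_natCast 2048000, eventually_mul_log_pow_le 1024000 6,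
      eventually_mul_log_pow_le 100 3] with n hlog hn hn' δ e hδ he M _ P hP
    refine hP.not_solvesCountDistinct_of_le_div_log_pow hlog hn (Nat.le_floor ?_)
      (Nat.floor_le (by positivity)) hδ he
    rwa [le_div_iff₀ (by positivity)]

theorem theorem2 :
    ∃ (ε : ℕ → ℝ) (D : ℕ → ℕ) (k : ℕ),
      -- `ε = ln n - O(ln ln n)`
      (∀ᶠ n : ℕ in atTop, ε n ≤ Real.log n) ∧
      ((fun n : ℕ => Real.log n - ε n) =O[atTop] fun n : ℕ => Real.log (Real.log n)) ∧
      -- `D = Θ(n / polylog n)`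
      ((fun n : ℕ => (D n : ℝ)) =Θ[atTop] fun n : ℕ => (n : ℝ) / Real.log n ^ k) ∧
      -- no `(ε, n ^ (-ω(1)))`-locally DP protocol has error `o(D)`
      ∀ δ : ℕ → ℝ, IsSuperpolynomiallySmall δ →
      ∀ e : ℕ → ℝ, e =o[atTop] (fun n : ℕ => (D n : ℝ)) →
      ∀ᶠ n : ℕ in atTop,
        ∀ (M : Type u) [MeasurableSpace M] (P : PublicCoinLocalProtocol n (Fin (D n)) M),
          P.IsLocallyDP (ε n) (δ n) → ¬ P.SolvesCountDistinct (e n) := by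
  obtain ⟨ε, D, k, ε_le, ε_ge, D_isTheta, not_solves⟩ := theorem2_general.{u}
  refine ⟨ε, D, k, ε_le, ε_ge, D_isTheta, fun δ hδ e he => ?_⟩
  filter_upwards [not_solves, hδ.eventually_natCast_mul_le (by norm_num : (0 : ℝ) < 1 / 40),
    he.bound (by norm_num : (0 : ℝ) < 1 / 16)] with n not_solves_n hδn hen
  rw [Real.norm_natCast, one_div_mul_eq_div] at hen
  exact not_solves_n (δ n) (e n) hδn ((le_abs_self _).trans hen)
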